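/- Let $H$ be a complex Hilbert space, $-\infty<a<b<\infty$ and $V=L^2((a,b),H)$. Let $H^1((a,b),H)$ be the space of all $u\in V$ that have a weak derivative $u'\in V$; each such $u$ is identified with its representative that is continuous on $[a,b]$. Let $H^2((a,b),H)=\{u\in H^1((a,b),H): u'\in H^1((a,b),H)\}$. For $v\in H^2((a,b),H)$ define in the Hilbert space $H\times H$ $$\Gamma_- v=\tfrac{\sqrt2}{2}\bigl(v(a)-i v'(a),\; v(b)+i v'(b)\bigr),\qquad \Gamma_+ v=\tfrac{\sqrt2}{2}\bigl(v(a)+i v'(a),\; v(b)-i v'(b)\bigr).$$ Let $S$ be the operator on $V$ with domain $D(S)=C_c^\infty((a,b),H)$ and $Sv=v''$, and let $T$ be a (linear, not necessarily bounded) operator on $V$ with $S\subset T$, that is, $D(S)\subset D(T)$ and $Tv=Sv$ for $v\in D(S)$. Then the following two statements hold. 1. $T$ is selfadjoint if and only if there is a unitary operator $\Phi\in\mathcal L(H\times H)$ such that $$D(T)=\{v\in H^2((a,b),H):\ \Phi\Gamma_- v=\Gamma_+ v\}\quad\text{and}\quad Tv=v''\ \text{ for all } v\in D(T).$$ 2.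 $iT$ is m-dissipative if and only if there is a linear contraction $\Phi\in\mathcal L(H\times H)$ (that is, $\|\Phi x\|\le\|x\|$ for all $x$) such that $$D(T)=\{v\in H^2((a,b),H):\ \Gamma_- v=\Phi\Gamma_+ v\}\quad\text{and}\quad Tv=v''\ \text{ for all } v\in D(T).$$ Here an operator $A$ on $V$ is called m-dissipative if $\operatorname{Re}\langle Ax,x\rangle_V\le 0$ for all $x\in D(A)$ and $(\mathrm{Id}-A)D(A)=V$. -/

import Mathlib

open MeasureTheory Set
open scoped ContDiff ENNReal

noncomputable section

namespace SecondDerivative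

/-- `C_c^∞((a,b), E)`: smooth functions on the line whose support is a compact subset of the open
interval `(a, b)`. -/
def IsTest {E : Type*} [NormedAddCommGroup E] [NormedSpace ℝ E] (a b : ℝ) (φ : ℝ → E) : Prop :=
  ContDiff ℝ ∞ φ ∧ HasCompactSupport φ ∧ tsupport φ ⊆ Ioo a b

section TestFacts

variable {E : Type*} [NormedAddCommGroup E] [NormedSpace ℝ E] {a b : ℝ} {φ ψ : ℝ → E}

theorem IsTest.derivative (h : IsTest a b φ) : IsTest a b (deriv φ) :=
  ⟨(contDiff_infty_iff_deriv.1 h.1).2, h.2.1.deriv,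
    tsupport_deriv_subset.trans h.2.2⟩

theorem IsTest.zero : IsTest a b (0 : ℝ → E) :=
  ⟨contDiff_const, HasCompactSupport.zero, by simp [tsupport]⟩

theorem IsTest.add (h : IsTest a b φ) (h' : IsTest a b ψ) : IsTest a b (φ + ψ) :=
  ⟨h.1.add h'.1, h.2.1.add h'.2.1,
    (tsupport_add φ ψ).trans (union_subset h.2.2 h'.2.2)⟩

theorem IsTest.smul {𝕜 : Type*} [RCLike 𝕜] [NormedSpace 𝕜 E] [SMulCommClass ℝ 𝕜 E]
    (c : 𝕜) (h : IsTest a b φ) :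
    IsTest a b (c • φ) :=
  ⟨contDiff_const_smul c |>.comp h.1, h.2.1.smul_left (f := fun _ => c),
    (closure_mono (Function.support_const_smul_subset c φ)).trans h.2.2⟩

theorem IsTest.memLp (h : IsTest a b φ) (p : ℝ≥0∞) :
    MemLp φ p (volume.restrict (Ioo a b)) :=
  (h.1.continuous.memLp_of_hasCompactSupport h.2.1).restrict _

theorem IsTest.eq_zero (h : IsTest a b φ) {t : ℝ} (ht : t ∉ Ioo a b) : φ t = 0 :=
  image_eq_zero_of_notMem_tsupport fun h' => ht (h.2.2 h')

end TestFacts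

section Sobolev

variable {H : Type*} [NormedAddCommGroup H] [InnerProductSpace ℂ H] {a b : ℝ}

/-- The Hilbert space `L²((a,b), H)`. -/
abbrev L2 (a b : ℝ) (H : Type*) [NormedAddCommGroup H] [InnerProductSpace ℂ H] : Type _ :=
  Lp H 2 (volume.restrict (Ioo a b))

/-- `v ∈ L²` is the weak derivative of `u ∈ L²` on `(a,b)`, tested against real-valued
functions. -/
def HasWeakDeriv (u v : L2 a b H) : Prop :=
  ∀ φ : ℝ → ℝ, IsTest a b φ →
    -∫ t in Ioo a b, deriv φ t • u t = ∫ t in Ioo a b, φ t • v t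

theorem integrable_L2 (u : L2 a b H) : Integrable u (volume.restrict (Ioo a b)) :=
  (Lp.memLp u).integrable (by norm_num)

theorem IsTest.integrable_smul {φ : ℝ → ℝ} (h : IsTest a b φ) (u : L2 a b H) :
    Integrable (fun t => φ t • u t) (volume.restrict (Ioo a b)) := by
  have := (Lp.memLp u).smul (r := 1) (h.memLp 2)
  exact memLp_one_iff_integrable.1 this

theorem HasWeakDeriv.add {u v u' v' : L2 a b H} (h : HasWeakDeriv u v)
    (h' : HasWeakDeriv u' v') : HasWeakDeriv (u + u') (v + v') := by
  intro φ hφ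
  have e1 : ∫ t in Ioo a b, deriv φ t • (u + u' : L2 a b H) t
      = (∫ t in Ioo a b, deriv φ t • u t) + ∫ t in Ioo a b, deriv φ t • u' t := by
    rw [← integral_add (hφ.derivative.integrable_smul u) (hφ.derivative.integrable_smul u')]
    refine integral_congr_ae ?_
    filter_upwards [Lp.coeFn_add u u'] with t ht
    rw [ht, Pi.add_apply, smul_add]
  have e2 : ∫ t in Ioo a b, φ t • (v + v' : L2 a b H) t
      = (∫ t in Ioo a b, φ t • v t) + ∫ t in Ioo a b, φ t • v' t := by
    rw [← integral_add (hφ.integrable_smul v) (hφ.integrable_smul v')]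
    refine integral_congr_ae ?_
    filter_upwards [Lp.coeFn_add v v'] with t ht
    rw [ht, Pi.add_apply, smul_add]
  rw [e1, e2, ← h φ hφ, ← h' φ hφ, neg_add]

theorem HasWeakDeriv.smul {u v : L2 a b H} (c : ℂ) (h : HasWeakDeriv u v) :
    HasWeakDeriv (c • u) (c • v) := by
  intro φ hφ
  have e (ψ : ℝ → ℝ) (w : L2 a b H) : ∫ t in Ioo a b, ψ t • (c • w : L2 a b H) t
      = c • ∫ t in Ioo a b, ψ t • w t := by
    rw [← integral_smul]
    refine integral_congr_ae ?_
    filter_upwards [Lp.coeFn_smul c w] with t ht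
    rw [ht, Pi.smul_apply, smul_comm]
  rw [e, e, ← h φ hφ, smul_neg]

theorem HasWeakDeriv.zero : HasWeakDeriv (0 : L2 a b H) 0 := by
  intro φ _
  have e (ψ : ℝ → ℝ) : ∫ t in Ioo a b, ψ t • (0 : L2 a b H) t = 0 := by
    rw [← integral_zero ℝ H]
    refine integral_congr_ae ?_
    filter_upwards [Lp.coeFn_zero H 2 (volume.restrict (Ioo a b))] with t ht
    rw [ht, Pi.zero_apply, smul_zero]
  rw [e, e, neg_zero]

variable [CompleteSpace H]

theorem HasWeakDeriv.unique {u v w : L2 a b H} (h : HasWeakDeriv u v) (h' : HasWeakDeriv u w) :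
    v = w := by
  refine Lp.ext ?_
  rw [Filter.EventuallyEq, ae_restrict_iff' measurableSet_Ioo]
  have key := isOpen_Ioo.ae_eq_zero_of_integral_contDiff_smul_eq_zero (μ := volume)
    (U := Ioo a b) (f := fun t => v t - w t)
    (IntegrableOn.locallyIntegrableOn ((integrable_L2 v).sub (integrable_L2 w)))
    (fun g g1 g2 g3 => by
      have hg : IsTest a b g := ⟨g1, g2, g3⟩
      rw [← setIntegral_eq_integral_of_forall_compl_eq_zero (s := Ioo a b)
        (fun t ht => by rw [hg.eq_zero ht, zero_smul])]
      simp only [smul_sub]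
      rw [integral_sub (hg.integrable_smul v) (hg.integrable_smul w), ← h g hg, ← h' g hg,
        sub_self])
  filter_upwards [key] with t ht hm using sub_eq_zero.1 (ht hm)

/-- The Sobolev space `H¹((a,b), H)`, as a subspace of `L²((a,b), H)`. -/
def H1 (a b : ℝ) (H : Type*) [NormedAddCommGroup H] [InnerProductSpace ℂ H]
    [CompleteSpace H] : Submodule ℂ (L2 a b H) where
  carrier := {u | ∃ v, HasWeakDeriv u v}
  zero_mem' := ⟨0, HasWeakDeriv.zero⟩
  add_mem' := fun ⟨v, hv⟩ ⟨w, hw⟩ => ⟨v + w, hv.add hw⟩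
  smul_mem' := fun c _ ⟨v, hv⟩ => ⟨c • v, hv.smul c⟩

/-- The weak derivative `u ↦ u'` on `H¹((a,b), H)`. -/
def weakDeriv : H1 a b H →ₗ[ℂ] L2 a b H where
  toFun u := u.2.choose
  map_add' u v := ((u + v).2.choose_spec).unique (u.2.choose_spec.add v.2.choose_spec)
  map_smul' c u := ((c • u).2.choose_spec).unique (u.2.choose_spec.smul c)

theorem hasWeakDeriv_weakDeriv (u : H1 a b H) : HasWeakDeriv (u : L2 a b H) (weakDeriv u) :=
  u.2.choose_spec

/-- The Sobolev space `H²((a,b), H) = {u ∈ H¹ : u' ∈ H¹}`, as a subspace of `L²((a,b), H)`. -/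
def H2 (a b : ℝ) (H : Type*) [NormedAddCommGroup H] [InnerProductSpace ℂ H]
    [CompleteSpace H] : Submodule ℂ (L2 a b H) :=
  ((H1 a b H).comap weakDeriv).map (H1 a b H).subtype

theorem mem_H2_iff {u : L2 a b H} :
    u ∈ H2 a b H ↔ ∃ h : u ∈ H1 a b H, weakDeriv ⟨u, h⟩ ∈ H1 a b H := by
  simp [H2]

theorem H2_le_H1 : H2 a b H ≤ H1 a b H := fun _ hu => (mem_H2_iff.1 hu).1

/-- The first derivative `v' ∈ H¹` of `v ∈ H²`. -/
def derivH2 : H2 a b H →ₗ[ℂ] H1 a b H :=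
  (weakDeriv.comp (Submodule.inclusion H2_le_H1)).codRestrict (H1 a b H)
    fun u => (mem_H2_iff.1 u.2).2

/-- The second derivative `v'' ∈ L²` of `v ∈ H²`. -/
def secondDeriv : H2 a b H →ₗ[ℂ] L2 a b H :=
  weakDeriv.comp derivH2

end Sobolev

section ContinuousRepresentative

variable {H : Type*} [NormedAddCommGroup H] [InnerProductSpace ℂ H] {a b : ℝ}

/-- A test function with vanishing integral is the derivative of a test function. -/
theorem IsTest.exists_primitive {φ : ℝ → ℝ} (h : IsTest a b φ)
    (h0 : ∫ t in Ioo a b, φ t = 0) (hab : a < b) :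
    IsTest a b (fun t => ∫ s in a..t, φ s) ∧
      ∀ t, deriv (fun t => ∫ s in a..t, φ s) t = φ t := by
  have hd : ∀ t, HasDerivAt (fun t => ∫ s in a..t, φ s) (φ t) t := fun t =>
    h.1.continuous.integral_hasStrictDerivAt a t |>.hasDerivAt
  have hd' : deriv (fun t => ∫ s in a..t, φ s) = φ := funext fun t => (hd t).deriv
  obtain ⟨c, d, hc, hd1, hK⟩ : ∃ c d, a < c ∧ d < b ∧ tsupport φ ⊆ Icc c d := by
    rcases (tsupport φ).eq_empty_or_nonempty with he | hne
    · exact ⟨(a + b) / 2, (a + b) / 2, by linarith, by linarith, by simp [he]⟩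
    · have hc : IsCompact (tsupport φ) := h.2.1
      exact ⟨sInf (tsupport φ), sSup (tsupport φ), (h.2.2 (hc.sInf_mem hne)).1,
        (h.2.2 (hc.sSup_mem hne)).2,
        fun x hx => ⟨csInf_le hc.bddBelow hx, le_csSup hc.bddAbove hx⟩⟩
  have hz : ∀ t, t ∉ Icc c d → φ t = 0 := fun t ht =>
    image_eq_zero_of_notMem_tsupport fun h' => ht (hK h')
  have hsub : tsupport (fun t => ∫ s in a..t, φ s) ⊆ Icc c d := by
    refine closure_minimal (fun t ht => ?_) isClosed_Icc
    by_contra hn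
    apply ht
    have hint : ∀ x y, IntervalIntegrable φ volume x y :=
      fun x y => h.1.continuous.intervalIntegrable x y
    rcases lt_or_ge t c with htc | htc
    · refine (intervalIntegral.integral_congr (g := fun _ => 0) fun s hs => ?_).trans (by simp)
      refine hz s fun hs' => ?_
      have := (mem_uIcc.1 hs)
      rcases this with h1 | h1 <;> linarith [hs'.1, h1.1, h1.2]
    · have htd : d < t := by
        by_contra h2
        exact hn ⟨htc, not_lt.1 h2⟩
      have e : ∫ s in t..b, φ s = 0 := by
        refine (intervalIntegral.integral_congr_ae (g := fun _ => 0) ?_).trans (by simp)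
        refine Filter.Eventually.of_forall fun s hs => hz s fun hs' => ?_
        rcases mem_uIoc.1 hs with h1 | h1 <;> linarith [hs'.2, h1.1, h1.2]
      have e2 : ∫ s in a..b, φ s = 0 := by
        rw [intervalIntegral.integral_of_le hab.le, integral_Ioc_eq_integral_Ioo, h0]
      have := intervalIntegral.integral_add_adjacent_intervals (hint a t) (hint t b)
      simpa [e, e2] using this
  refine ⟨⟨contDiff_infty_iff_deriv.2 ⟨fun t => (hd t).differentiableAt, by rw [hd']; exact h.1⟩,
    HasCompactSupport.of_support_subset_isCompact isCompact_Icc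
      (subset_closure.trans hsub), hsub.trans fun t ht => ⟨by linarith [ht.1], by linarith [ht.2]⟩⟩,
    fun t => (hd t).deriv⟩

/-- Elements of `H¹((a,b), H)` have a representative that is continuous on `[a, b]`. -/
theorem exists_contRep [CompleteSpace H] (u : H1 a b H) :
    ∃ f : ℝ → H, ContinuousOn f (Icc a b) ∧
      (u : L2 a b H) =ᵐ[volume.restrict (Ioo a b)] f := by
  rcases le_or_gt b a with hba | hab
  · exact ⟨0, continuousOn_const, by simp [Ioo_eq_empty (not_lt.2 hba), Filter.EventuallyEq]⟩
  set v : L2 a b H := weakDeriv u with hv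
  set μ := volume.restrict (Ioo a b) with hμ
  have hvi : Integrable v μ := integrable_L2 v
  have hvI : IntegrableOn v (Icc a b) := by
    rw [integrableOn_Icc_iff_integrableOn_Ioo]; exact hvi
  let W : ℝ → H := fun s => ∫ t in s..b, v t
  have hW : ContinuousOn W (Icc a b) := by
    have := intervalIntegral.continuousOn_primitive_interval_left (f := v) (a := a) (b := b)
      (μ := volume) (by rwa [uIcc_of_le hab.le])
    rwa [uIcc_of_le hab.le] at this
  have hWI : Integrable W μ := by
    have h1 : IntegrableOn W (Icc a b) := hW.integrableOn_compact isCompact_Icc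
    exact h1.mono_set Ioo_subset_Icc_self
  have htest : ∀ {φ : ℝ → ℝ}, IsTest a b φ → ∀ {g : ℝ → H}, Integrable g μ →
      Integrable (fun t => φ t • g t) μ := by
    intro φ hφ g hg
    obtain ⟨C, hC⟩ := hφ.1.continuous.bounded_above_of_compact_support hφ.2.1
    exact hg.bdd_smul (𝕜 := ℝ) (φ := φ) C hφ.1.continuous.aestronglyMeasurable
      (Filter.Eventually.of_forall hC)
  have hui : Integrable (u : L2 a b H) μ := integrable_L2 _
  have key : ∀ φ : ℝ → ℝ, IsTest a b φ → ∫ t in Ioo a b, φ t = 0 →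
      ∫ t in Ioo a b, φ t • ((u : L2 a b H) t + W t) = 0 := by
    intro φ hφ h0
    obtain ⟨hξ, hξd⟩ := hφ.exists_primitive h0 hab
    have e1 := hasWeakDeriv_weakDeriv u _ hξ
    simp only [hξd] at e1
    have hφi : Integrable φ μ := hφ.memLp 1 |>.integrable le_rfl
    have hF : Integrable (Function.uncurry fun t s => ({p : ℝ × ℝ | p.2 < p.1}.indicator
        (fun p => φ p.2 • v p.1)) (t, s)) (μ.prod μ) := by
      have h1 := (hφi.smul_prod hvi).swap
      exact h1.indicator (measurableSet_lt measurable_snd measurable_fst)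
    have e2 := integral_integral_swap hF
    have e3 : ∀ t ∈ Ioo a b, (∫ s in Ioo a b, ({p : ℝ × ℝ | p.2 < p.1}.indicator
        (fun p => φ p.2 • v p.1)) (t, s)) = (∫ s in a..t, φ s) • v t := by
      intro t ht
      rw [intervalIntegral.integral_of_le ht.1.le, integral_Ioc_eq_integral_Ioo,
        ← integral_smul_const]
      have : Ioo a t = Ioo a b ∩ Iio t := by
        ext x; simp only [mem_Ioo, mem_inter_iff, mem_Iio]; constructor
        · rintro ⟨h1, h2⟩; exact ⟨⟨h1, h2.trans ht.2⟩, h2⟩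
        · rintro ⟨⟨h1, _⟩, h2⟩; exact ⟨h1, h2⟩
      rw [this, ← setIntegral_indicator measurableSet_Iio]
      rfl
    have e4 : ∀ s ∈ Ioo a b, (∫ t in Ioo a b, ({p : ℝ × ℝ | p.2 < p.1}.indicator
        (fun p => φ p.2 • v p.1)) (t, s)) = φ s • W s := by
      intro s hs
      simp only [W]
      rw [intervalIntegral.integral_of_le hs.2.le, integral_Ioc_eq_integral_Ioo,
        ← integral_smul]
      have : Ioo s b = Ioo a b ∩ Ioi s := by
        ext x; simp only [mem_Ioo, mem_inter_iff, mem_Ioi]; constructor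
        · rintro ⟨h1, h2⟩; exact ⟨⟨hs.1.trans h1, h2⟩, h1⟩
        · rintro ⟨⟨_, h1⟩, h2⟩; exact ⟨h2, h1⟩
      rw [this, ← setIntegral_indicator measurableSet_Ioi]
      rfl
    rw [setIntegral_congr_fun measurableSet_Ioo e3, setIntegral_congr_fun measurableSet_Ioo e4,
      ← e1] at e2
    simp only [smul_add]
    rw [integral_add (hφ.integrable_smul _) (htest hφ hWI), ← e2, add_neg_cancel]
  let ψ₀ : ContDiffBump ((a + b) / 2) :=
    ⟨(b - a) / 8, (b - a) / 4, by linarith, by linarith⟩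
  let ψ : ℝ → ℝ := ψ₀.normed volume
  have hψ : IsTest a b ψ := by
    refine ⟨ψ₀.contDiff_normed, ψ₀.hasCompactSupport_normed, ?_⟩
    rw [ψ₀.tsupport_normed_eq, Real.closedBall_eq_Icc]
    intro t ht
    have h1 : ψ₀.rOut = (b - a) / 4 := rfl
    rw [h1] at ht
    exact ⟨by linarith [ht.1], by linarith [ht.2]⟩
  have hψ1 : ∫ t in Ioo a b, ψ t = 1 := by
    rw [setIntegral_eq_integral_of_forall_compl_eq_zero (fun t ht => hψ.eq_zero ht)]
    exact ψ₀.integral_normed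
  let c : H := ∫ t in Ioo a b, ψ t • ((u : L2 a b H) t + W t)
  have hgi : Integrable (fun t => (u : L2 a b H) t + W t) μ := hui.add hWI
  have main := isOpen_Ioo.ae_eq_zero_of_integral_contDiff_smul_eq_zero (μ := volume)
    (U := Ioo a b) (f := fun t => ((u : L2 a b H) t + W t) - c)
    (IntegrableOn.locallyIntegrableOn (hgi.sub (integrable_const c)))
    (fun φ g1 g2 g3 => by
      have hφ : IsTest a b φ := ⟨g1, g2, g3⟩
      rw [← setIntegral_eq_integral_of_forall_compl_eq_zero (s := Ioo a b)
        (fun t ht => by rw [hφ.eq_zero ht, zero_smul])]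
      have hφi : Integrable φ μ := hφ.memLp 1 |>.integrable le_rfl
      have hψi : Integrable ψ μ := hψ.memLp 1 |>.integrable le_rfl
      set m := ∫ t in Ioo a b, φ t with hm
      have hk : IsTest a b (φ + (-m) • ψ) := hφ.add (hψ.smul (-m))
      have h1 := key _ hk (by
        simp only [Pi.add_apply, Pi.smul_apply]
        have e := integral_add hφi (hψi.smul (-m))
        simp only [Pi.smul_apply] at e
        rw [e, integral_smul, hψ1]
        simp [hm, hμ])
      simp only [Pi.add_apply, Pi.smul_apply, add_smul, smul_assoc] at h1
      have e := integral_add (htest hφ hgi) ((htest hψ hgi).smul (-m))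
      simp only [Pi.smul_apply] at e
      rw [e, integral_smul] at h1
      simp only [smul_sub]
      rw [integral_sub (htest hφ hgi) (hφi.smul_const c), integral_smul_const, ← hm]
      rw [neg_smul, ← sub_eq_add_neg] at h1
      exact h1)
  refine ⟨fun t => c - W t, continuousOn_const.sub hW, ?_⟩
  rw [Filter.EventuallyEq, ae_restrict_iff' measurableSet_Ioo]
  filter_upwards [main] with t ht hm
  exact eq_sub_of_add_eq (sub_eq_zero.1 (ht hm))

variable [CompleteSpace H]

/-- The continuous representative of `u ∈ H¹((a,b), H)`; only its values on `[a, b]` matter, and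
there it is unique. -/
def contRep (u : H1 a b H) : ℝ → H := (exists_contRep u).choose

theorem continuousOn_contRep (u : H1 a b H) : ContinuousOn (contRep u) (Icc a b) :=
  (exists_contRep u).choose_spec.1

theorem ae_eq_contRep (u : H1 a b H) :
    (u : L2 a b H) =ᵐ[volume.restrict (Ioo a b)] contRep u :=
  (exists_contRep u).choose_spec.2

end ContinuousRepresentative

section Boundary

variable {H : Type*} [NormedAddCommGroup H] [InnerProductSpace ℂ H] [CompleteSpace H] {a b : ℝ}

/-- The value `v(t)` of `v ∈ H²` at `t ∈ [a, b]`. -/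
def val (v : H2 a b H) (t : ℝ) : H := contRep (Submodule.inclusion H2_le_H1 v) t

/-- The value `v'(t)` of the derivative of `v ∈ H²` at `t ∈ [a, b]`. -/
def derivVal (v : H2 a b H) (t : ℝ) : H := contRep (derivH2 v) t

/-- `Γ₋ v = (√2/2) (v(a) - i v'(a), v(b) + i v'(b))`, in the Hilbert space `H × H`. -/
def Γm (v : H2 a b H) : WithLp 2 (H × H) :=
  ((√2 / 2 : ℝ) : ℂ) • WithLp.toLp 2
    (val v a - Complex.I • derivVal v a, val v b + Complex.I • derivVal v b)

/-- `Γ₊ v = (√2/2) (v(a) + i v'(a), v(b) - i v'(b))`, in the Hilbert space `H × H`. -/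
def Γp (v : H2 a b H) : WithLp 2 (H × H) :=
  ((√2 / 2 : ℝ) : ℂ) • WithLp.toLp 2
    (val v a + Complex.I • derivVal v a, val v b - Complex.I • derivVal v b)

end Boundary

section Operators

variable {H : Type*} [NormedAddCommGroup H] [InnerProductSpace ℂ H] {a b : ℝ}

/-- The space `C_c^∞((a,b), H)`. -/
def testSpace (a b : ℝ) (H : Type*) [NormedAddCommGroup H] [InnerProductSpace ℂ H] :
    Submodule ℂ (ℝ → H) where
  carrier := {φ | IsTest a b φ}
  zero_mem' := IsTest.zero
  add_mem' := IsTest.add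
  smul_mem' c _ h := IsTest.smul c h

/-- The class in `L²((a,b), H)` of a test function. -/
def testToL2 : testSpace a b H →ₗ[ℂ] L2 a b H where
  toFun φ := (IsTest.memLp φ.2 2).toLp φ.1
  map_add' _ _ := rfl
  map_smul' _ _ := rfl

theorem testToL2_injective : Function.Injective (testToL2 (a := a) (b := b) (H := H)) := by
  intro φ ψ h
  have h1 : (φ : ℝ → H) =ᵐ[volume.restrict (Ioo a b)] ψ :=
    (MemLp.toLp_eq_toLp_iff (IsTest.memLp φ.2 2) (IsTest.memLp ψ.2 2)).1 h
  have h2 := Measure.eqOn_open_of_ae_eq h1 isOpen_Ioo φ.2.1.continuous.continuousOn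
    ψ.2.1.continuous.continuousOn
  ext t
  by_cases ht : t ∈ Ioo a b
  · exact h2 ht
  · rw [IsTest.eq_zero φ.2 ht, IsTest.eq_zero ψ.2 ht]

/-- The classical second derivative on test functions. -/
def testSecondDeriv : testSpace a b H →ₗ[ℂ] testSpace a b H where
  toFun φ := ⟨deriv (deriv φ.1), IsTest.derivative (IsTest.derivative φ.2)⟩
  map_add' φ ψ := by
    ext t
    have e : deriv ((φ : ℝ → H) + (ψ : ℝ → H)) = deriv φ.1 + deriv ψ.1 := by
      ext s
      exact deriv_add (φ.2.1.differentiable (by simp) s) (ψ.2.1.differentiable (by simp) s)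
    simp only [Submodule.coe_add, e, Pi.add_apply]
    exact deriv_add ((IsTest.derivative φ.2).1.differentiable (by simp) t)
      ((IsTest.derivative ψ.2).1.differentiable (by simp) t)
  map_smul' c φ := by
    ext t
    have e : deriv (c • (φ : ℝ → H)) = c • deriv φ.1 := by
      ext s
      exact deriv_const_smul c (φ.2.1.differentiable (by simp) s)
    simp only [Submodule.coe_smul, e, RingHom.id_apply, Pi.smul_apply]
    exact deriv_const_smul c ((IsTest.derivative φ.2).1.differentiable (by simp) t)

/-- The operator `S v = v''` with domain `C_c^∞((a,b), H)` in `L²((a,b), H)`. -/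
def S (a b : ℝ) (H : Type*) [NormedAddCommGroup H] [InnerProductSpace ℂ H] :
    L2 a b H →ₗ.[ℂ] L2 a b H where
  domain := LinearMap.range testToL2
  toFun := (testToL2.comp testSecondDeriv).comp
    (LinearEquiv.ofInjective testToL2 testToL2_injective).symm.toLinearMap

theorem S_apply (φ : testSpace a b H) :
    S a b H ⟨testToL2 φ, LinearMap.mem_range_self _ φ⟩ = testToL2 (testSecondDeriv φ) := by
  have : (LinearEquiv.ofInjective testToL2 testToL2_injective).symm
      ⟨testToL2 φ, LinearMap.mem_range_self _ φ⟩ = φ :=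
    (LinearEquiv.symm_apply_eq _).2 rfl
  exact congrArg (fun ψ => testToL2 (testSecondDeriv ψ)) this

/-- An operator `A` on a Hilbert space is m-dissipative if `Re ⟨A x, x⟩ ≤ 0` for all `x ∈ D(A)` and
`(Id - A) D(A)` is the whole space. -/
def IsMDissipative {V : Type*} [NormedAddCommGroup V] [InnerProductSpace ℂ V]
    (A : V →ₗ.[ℂ] V) : Prop :=
  (∀ x : A.domain, (inner ℂ (A x) (x : V)).re ≤ 0) ∧
    ∀ y : V, ∃ x : A.domain, (x : V) - A x = y

end Operators

end SecondDerivative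

/-! Everything happens at the boundary. Two integrations by parts give Green's formula `⟨Γ₊v, Γ₊w⟩ -
⟨Γ₋v, Γ₋w⟩ = i (⟨v'', w⟩ - ⟨v, w''⟩)` on `H²` (`inner_Γp_sub_inner_Γm`), whose diagonal is `Re
⟨iv'', v⟩ = (‖Γ₋v‖² - ‖Γ₊v‖²) / 2`. Thus a restriction of `v ↦ v''` is symmetric iff `Γ₋v ↦ Γ₊v` is
isometric on its domain, and `i` times it is dissipative iff `Γ₊v ↦ Γ₋v` is contractive. Two further
facts make this a classification: the pair `(Γ₋, Γ₊)` takes all values (`exists_Γm_Γp_eq`), and the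
adjoint of `S` is the second derivative on `H²` (`exists_mem_H2_of_forall_inner_eq`).

An admissible `T` lies below that adjoint: by symmetry if `T` is selfadjoint; if `iT` is
dissipative, because its form vanishes on test functions, which forces skew-symmetry against them.

Selfadjointness makes `D(T)` contain every `v` whose boundary form vanishes against `D(T)`. Hence
both boundary ranges are dense and the isometry extends to a unitary. Conversely, the condition
adjoint to `ΦΓ₋ = Γ₊` is `Γ₋ = Φ*Γ₊`, the same condition when `Φ` is unitary.

In the dissipative case the contraction is extended by zero off the closure of its domain. The
domain thus described cannot exceed `D(T)`, since `1 - iT` is already onto and `v = iv''` has only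
the zero solution under a contractive condition. Conversely, `1 - i∂²` under such a condition has
closed range by the dissipative estimate, and dense range because the adjoint problem has only the
zero solution. -/

namespace SecondDerivative

/-! ### Primitives of integrable functions and integration by parts -/

section Primitive

variable {E F G : Type*} [NormedAddCommGroup E] [NormedSpace ℝ E]
  [NormedAddCommGroup F] [NormedSpace ℝ F] [NormedAddCommGroup G] [NormedSpace ℝ G] {a b : ℝ}

/-- `F` is a primitive on `[a, b]` of the integrable function `f`. -/
structure IsPrimitive (a b : ℝ) (F f : ℝ → E) : Prop where
  integrableOn : IntegrableOn f (Ioo a b)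
  eq_add : ∀ t ∈ Icc a b, F t = F a + ∫ s in a..t, f s

/-- Moves the dependence on `t` from the domain into the integrand, so that Fubini and a.e.
arguments apply over one fixed measure. -/
theorem intervalIntegral_eq_integral_indicator {f : ℝ → E} {t : ℝ} (ht : t ∈ Icc a b) :
    ∫ s in a..t, f s = ∫ s in Ioo a b, (Iio t).indicator f s := by
  rw [intervalIntegral.integral_of_le ht.1, integral_Ioc_eq_integral_Ioo,
    setIntegral_indicator measurableSet_Iio]
  congr 2
  ext x
  simp only [mem_Ioo, mem_inter_iff, mem_Iio]
  exact ⟨fun h => ⟨⟨h.1, h.2.trans_le ht.2⟩, h.2⟩, fun h => ⟨h.1.1, h.2⟩⟩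

theorem continuousOn_intervalIntegral {f : ℝ → E} (hab : a ≤ b) (hf : IntegrableOn f (Ioo a b)) :
    ContinuousOn (fun t => ∫ s in a..t, f s) (Icc a b) := by
  have := intervalIntegral.continuousOn_primitive_interval (f := f) (a := a) (b := b)
    (μ := volume) (by rw [uIcc_of_le hab]; exact (integrableOn_Icc_iff_integrableOn_Ioo).2 hf)
  rwa [uIcc_of_le hab] at this

theorem isPrimitive_const_add {f : ℝ → E} (x : E) (hf : IntegrableOn f (Ioo a b)) :
    IsPrimitive a b (fun t => x + ∫ s in a..t, f s) f :=
  ⟨hf, fun t _ => by simp⟩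

namespace IsPrimitive

theorem continuousOn {F f : ℝ → E} (h : IsPrimitive a b F f) : ContinuousOn F (Icc a b) := by
  rcases lt_or_ge b a with hba | hab
  · simp [Icc_eq_empty (not_le.2 hba)]
  exact (continuousOn_const.add (continuousOn_intervalIntegral hab h.integrableOn)).congr h.eq_add

theorem of_contDiff {F : ℝ → E} [CompleteSpace E] (h : ContDiff ℝ 1 F) :
    IsPrimitive a b F (deriv F) := by
  have hc : Continuous (deriv F) := h.continuous_deriv le_rfl
  refine ⟨hc.integrableOn_Icc.mono_set Ioo_subset_Icc_self, fun t _ => ?_⟩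
  rw [intervalIntegral.integral_deriv_eq_sub
    (fun x _ => h.differentiable (by simp) x) (hc.intervalIntegrable a t)]
  abel

theorem congr {F F' f f' : ℝ → E} (h : IsPrimitive a b F f) (hF : EqOn F' F (Icc a b))
    (hf : f' =ᵐ[volume.restrict (Ioo a b)] f) : IsPrimitive a b F' f' := by
  refine ⟨h.integrableOn.congr hf.symm, fun t ht => ?_⟩
  rw [hF ht, hF ⟨le_rfl, ht.1.trans ht.2⟩, h.eq_add t ht,
    intervalIntegral_eq_integral_indicator ht, intervalIntegral_eq_integral_indicator ht]
  congr 1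
  refine integral_congr_ae ?_
  filter_upwards [hf] with s hs
  simp [indicator, hs]

end IsPrimitive

theorem integrableOn_bilin_left (B : E →L[ℝ] F →L[ℝ] G) {f : ℝ → E} {W : ℝ → F}
    (hf : IntegrableOn f (Ioo a b)) (hW : ContinuousOn W (Icc a b)) :
    IntegrableOn (fun t => B (f t) (W t)) (Ioo a b) := by
  obtain ⟨C, hC⟩ := isCompact_Icc.exists_bound_of_continuousOn hW
  have hWm := (hW.mono Ioo_subset_Icc_self).aestronglyMeasurable (μ := volume) measurableSet_Ioo
  refine Integrable.mono' (g := fun t => ‖B‖ * ‖f t‖ * C) ((hf.norm.const_mul _).mul_const _) ?_ ?_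
  · exact (by fun_prop : Continuous fun p : E × F => B p.1 p.2).comp_aestronglyMeasurable
      (hf.aestronglyMeasurable.prodMk hWm)
  · rw [ae_restrict_iff' measurableSet_Ioo]
    refine Filter.Eventually.of_forall fun t ht => ?_
    exact (B.le_opNorm₂ _ _).trans
      (mul_le_mul_of_nonneg_left (hC t (Ioo_subset_Icc_self ht)) (by positivity))

theorem integrableOn_bilin_right (B : E →L[ℝ] F →L[ℝ] G) {U : ℝ → E} {w : ℝ → F}
    (hw : IntegrableOn w (Ioo a b)) (hU : ContinuousOn U (Icc a b)) :
    IntegrableOn (fun t => B (U t) (w t)) (Ioo a b) :=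
  integrableOn_bilin_left B.flip hw hU

variable [CompleteSpace E] [CompleteSpace F] [CompleteSpace G]

/-- Integration by parts for primitives starting at `0`, by Fubini's theorem. -/
theorem integral_bilin_intervalIntegral (B : E →L[ℝ] F →L[ℝ] G) {f : ℝ → E} {g : ℝ → F}
    (hab : a ≤ b) (hf : IntegrableOn f (Ioo a b)) (hg : IntegrableOn g (Ioo a b)) :
    (∫ t in Ioo a b, B (f t) (∫ s in a..t, g s)) + ∫ t in Ioo a b, B (∫ s in a..t, f s) (g t)
      = B (∫ t in a..b, f t) (∫ t in a..b, g t) := by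
  set μ := volume.restrict (Ioo a b) with hμ
  have hI : Integrable (fun p : ℝ × ℝ => B (f p.1) (g p.2)) (μ.prod μ) :=
    hf.op_fst_snd (by fun_prop) ⟨‖B‖, B.le_opNorm₂⟩ hg
  have hm : MeasurableSet {p : ℝ × ℝ | p.2 < p.1} := measurableSet_lt measurable_snd measurable_fst
  have e1 : ∫ t in Ioo a b, B (f t) (∫ s in a..t, g s)
      = ∫ p, {p : ℝ × ℝ | p.2 < p.1}.indicator (fun p => B (f p.1) (g p.2)) p ∂(μ.prod μ) := by
    rw [integral_prod _ (hI.indicator hm)]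
    refine setIntegral_congr_fun measurableSet_Ioo fun t ht => ?_
    have ht' := Ioo_subset_Icc_self ht
    rw [intervalIntegral_eq_integral_indicator ht', ← ContinuousLinearMap.integral_comp_comm _
      (hg.indicator measurableSet_Iio)]
    refine integral_congr_ae (Filter.Eventually.of_forall fun s => ?_)
    by_cases h : s < t <;> simp [indicator, h]
  have e2 : ∫ t in Ioo a b, B (∫ s in a..t, f s) (g t)
      = ∫ p, {p : ℝ × ℝ | p.2 < p.1}ᶜ.indicator (fun p => B (f p.1) (g p.2)) p ∂(μ.prod μ) := by
    rw [integral_prod_symm _ (hI.indicator hm.compl)]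
    refine setIntegral_congr_fun measurableSet_Ioo fun t ht => ?_
    have ht' := Ioo_subset_Icc_self ht
    -- The complement of the open triangle contains the diagonal, so the slice is `s ≤ t`; the added
    -- point is null.
    have e : ∫ s in a..t, f s = ∫ s in Ioo a b, (Iic t).indicator f s := by
      rw [intervalIntegral_eq_integral_indicator ht']
      refine integral_congr_ae ?_
      have : ∀ᵐ s ∂μ, s ≠ t := by
        rw [hμ]; exact ae_restrict_of_ae (Measure.ae_ne volume t)
      filter_upwards [this] with s hs
      simp [indicator, lt_iff_le_and_ne, hs]
    rw [e, ← ContinuousLinearMap.flip_apply, ← ContinuousLinearMap.integral_comp_comm _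
      (hf.indicator measurableSet_Iic)]
    refine integral_congr_ae (Filter.Eventually.of_forall fun s => ?_)
    by_cases h : s ≤ t <;> simp [indicator, h]
  rw [e1, e2, ← integral_add (hI.indicator hm) (hI.indicator hm.compl)]
  have e3 : ∀ p, {p : ℝ × ℝ | p.2 < p.1}.indicator (fun p => B (f p.1) (g p.2)) p
      + {p : ℝ × ℝ | p.2 < p.1}ᶜ.indicator (fun p => B (f p.1) (g p.2)) p = B (f p.1) (g p.2) :=
    fun p => indicator_self_add_compl_apply _ _ _
  simp only [e3]
  rw [intervalIntegral.integral_of_le hab, intervalIntegral.integral_of_le hab,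
    integral_Ioc_eq_integral_Ioo, integral_Ioc_eq_integral_Ioo]
  exact integral_prod_bilin B hf hg

/-- Integration by parts. -/
theorem IsPrimitive.integral_bilin (B : E →L[ℝ] F →L[ℝ] G) {U u : ℝ → E} {W w : ℝ → F}
    (hab : a ≤ b) (hU : IsPrimitive a b U u) (hW : IsPrimitive a b W w) :
    (∫ t in Ioo a b, B (u t) (W t)) + ∫ t in Ioo a b, B (U t) (w t)
      = B (U b) (W b) - B (U a) (W a) := by
  have key := integral_bilin_intervalIntegral B hab hU.integrableOn hW.integrableOn
  have e1 : ∫ t in Ioo a b, B (u t) (W t)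
      = B (∫ t in a..b, u t) (W a) + ∫ t in Ioo a b, B (u t) (∫ s in a..t, w s) := by
    rw [intervalIntegral.integral_of_le hab, integral_Ioc_eq_integral_Ioo,
      ← ContinuousLinearMap.flip_apply, ← ContinuousLinearMap.integral_comp_comm _ hU.integrableOn,
      ← integral_add ((B.flip (W a)).integrable_comp hU.integrableOn)
        (integrableOn_bilin_left B hU.integrableOn
          (continuousOn_intervalIntegral hab hW.integrableOn))]
    refine setIntegral_congr_fun measurableSet_Ioo fun t ht => ?_
    simp [hW.eq_add t (Ioo_subset_Icc_self ht)]
  have e2 : ∫ t in Ioo a b, B (U t) (w t)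
      = B (U a) (∫ t in a..b, w t) + ∫ t in Ioo a b, B (∫ s in a..t, u s) (w t) := by
    rw [intervalIntegral.integral_of_le hab, integral_Ioc_eq_integral_Ioo,
      ← ContinuousLinearMap.integral_comp_comm _ hW.integrableOn,
      ← integral_add ((B (U a)).integrable_comp hW.integrableOn)
        (integrableOn_bilin_right B hW.integrableOn
          (continuousOn_intervalIntegral hab hU.integrableOn))]
    refine setIntegral_congr_fun measurableSet_Ioo fun t ht => ?_
    simp [hU.eq_add t (Ioo_subset_Icc_self ht)]
  rw [e1, e2, hU.eq_add b ⟨hab, le_rfl⟩, hW.eq_add b ⟨hab, le_rfl⟩]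
  simp only [map_add, add_apply]
  rw [← key]
  abel

end Primitive

/-! ### Continuous functions on the closed interval -/

section ContinuousOnIcc

variable {E : Type*} [NormedAddCommGroup E] {a b : ℝ}

theorem eqOn_Icc_of_ae_eq_Ioo {f g : ℝ → E} (hab : a < b)
    (h : f =ᵐ[volume.restrict (Ioo a b)] g) (hf : ContinuousOn f (Icc a b))
    (hg : ContinuousOn g (Icc a b)) : EqOn f g (Icc a b) :=
  Measure.eqOn_Icc_of_ae_eq volume hab.ne
    (by rwa [restrict_Ioo_eq_restrict_Icc] at h) hf hg

theorem memLp_of_continuousOn_Icc {f : ℝ → E} (hf : ContinuousOn f (Icc a b)) :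
    MemLp f 2 (volume.restrict (Ioo a b)) := by
  obtain ⟨C, hC⟩ := isCompact_Icc.exists_bound_of_continuousOn hf
  refine MemLp.of_bound
    ((hf.mono Ioo_subset_Icc_self).aestronglyMeasurable measurableSet_Ioo) C ?_
  rw [ae_restrict_iff' measurableSet_Ioo]
  exact Filter.Eventually.of_forall fun t ht => hC t (Ioo_subset_Icc_self ht)

end ContinuousOnIcc

/-! ### Fundamental lemma of the calculus of variations and du Bois-Reymond's lemma -/

section DuBoisReymond

variable {E : Type*} [NormedAddCommGroup E] [NormedSpace ℝ E] {a b : ℝ}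

theorem IsTest.integrable_smul_integrable {φ : ℝ → ℝ} (hφ : IsTest a b φ) {g : ℝ → E}
    (hg : IntegrableOn g (Ioo a b)) : IntegrableOn (fun t => φ t • g t) (Ioo a b) := by
  obtain ⟨C, hC⟩ := hφ.1.continuous.bounded_above_of_compact_support hφ.2.1
  exact hg.bdd_smul (𝕜 := ℝ) (φ := φ) C hφ.1.continuous.aestronglyMeasurable
    (Filter.Eventually.of_forall hC)

theorem IsTest.integrableOn {φ : ℝ → ℝ} (hφ : IsTest a b φ) : IntegrableOn φ (Ioo a b) :=
  (hφ.memLp 1).integrable le_rfl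

theorem exists_isTest_integral_eq_one (hab : a < b) :
    ∃ η : ℝ → ℝ, IsTest a b η ∧ ∫ t in Ioo a b, η t = 1 := by
  let ψ₀ : ContDiffBump ((a + b) / 2) :=
    -- Any outer radius below `(b - a) / 2` keeps the closed ball about the midpoint inside the open
    -- interval.
    ⟨(b - a) / 8, (b - a) / 4, by linarith, by linarith⟩
  have hψ : IsTest a b (ψ₀.normed volume) := by
    refine ⟨ψ₀.contDiff_normed, ψ₀.hasCompactSupport_normed, ?_⟩
    rw [ψ₀.tsupport_normed_eq, Real.closedBall_eq_Icc]
    intro t ht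
    have h1 : ψ₀.rOut = (b - a) / 4 := rfl
    rw [h1] at ht
    exact ⟨by linarith [ht.1], by linarith [ht.2]⟩
  refine ⟨_, hψ, ?_⟩
  rw [setIntegral_eq_integral_of_forall_compl_eq_zero (fun t ht => hψ.eq_zero ht)]
  exact ψ₀.integral_normed

/-- Every test function is a multiple of a fixed one plus the derivative of a test function. -/
theorem IsTest.exists_deriv_eq_sub {φ η : ℝ → ℝ} (hab : a < b) (hφ : IsTest a b φ)
    (hη : IsTest a b η) (h1 : ∫ t in Ioo a b, η t = 1) :
    ∃ ψ : ℝ → ℝ, IsTest a b ψ ∧ deriv ψ = fun t => φ t - (∫ s in Ioo a b, φ s) * η t := by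
  set m := ∫ s in Ioo a b, φ s with hm
  have hk : IsTest a b (fun t => φ t - m * η t) := by
    have := hφ.add (hη.smul (-m))
    convert this using 2
    simp [sub_eq_add_neg]
  obtain ⟨h2, h3⟩ := hk.exists_primitive (by
    rw [integral_sub hφ.integrableOn (hη.integrableOn.const_mul m), integral_const_mul, h1, ← hm]
    ring) hab
  exact ⟨_, h2, funext h3⟩

theorem IsTest.integral_sub_const_mul_smul {φ η : ℝ → ℝ} (hφ : IsTest a b φ) (hη : IsTest a b η)
    (m : ℝ) {g : ℝ → E} (hg : IntegrableOn g (Ioo a b)) :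
    ∫ t in Ioo a b, (φ t - m * η t) • g t
      = (∫ t in Ioo a b, φ t • g t) - m • ∫ t in Ioo a b, η t • g t := by
  rw [← integral_smul]
  simp only [sub_smul, mul_smul]
  exact integral_sub (hφ.integrable_smul_integrable hg)
    ((hη.integrable_smul_integrable hg).smul m)

variable [CompleteSpace E]

theorem ae_eq_of_forall_integral_smul_eq {f g : ℝ → E}
    (hf : IntegrableOn f (Ioo a b)) (hg : IntegrableOn g (Ioo a b))
    (h : ∀ φ : ℝ → ℝ, IsTest a b φ →
      ∫ t in Ioo a b, φ t • f t = ∫ t in Ioo a b, φ t • g t) :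
    f =ᵐ[volume.restrict (Ioo a b)] g := by
  rw [Filter.EventuallyEq, ae_restrict_iff' measurableSet_Ioo]
  have key := isOpen_Ioo.ae_eq_zero_of_integral_contDiff_smul_eq_zero (μ := volume)
    (U := Ioo a b) (f := fun t => f t - g t)
    (IntegrableOn.locallyIntegrableOn (hf.sub hg))
    (fun φ g1 g2 g3 => by
      have hφ : IsTest a b φ := ⟨g1, g2, g3⟩
      rw [← setIntegral_eq_integral_of_forall_compl_eq_zero (s := Ioo a b)
        (fun t ht => by rw [hφ.eq_zero ht, zero_smul])]
      simp only [smul_sub]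
      rw [integral_sub (hφ.integrable_smul_integrable hf) (hφ.integrable_smul_integrable hg),
        h φ hφ, sub_self])
  filter_upwards [key] with t ht hm using sub_eq_zero.1 (ht hm)

/-- The lemma of du Bois-Reymond. -/
theorem exists_ae_eq_const_of_forall_integral_deriv_smul_eq_zero {f : ℝ → E} (hab : a < b)
    (hf : IntegrableOn f (Ioo a b))
    (h : ∀ φ : ℝ → ℝ, IsTest a b φ → ∫ t in Ioo a b, deriv φ t • f t = 0) :
    ∃ c : E, f =ᵐ[volume.restrict (Ioo a b)] fun _ => c := by
  obtain ⟨η, hη, h1⟩ := exists_isTest_integral_eq_one hab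
  refine ⟨∫ t in Ioo a b, η t • f t, ae_eq_of_forall_integral_smul_eq hf (integrable_const _)
    fun φ hφ => ?_⟩
  obtain ⟨ψ, hψ, hd⟩ := hφ.exists_deriv_eq_sub hab hη h1
  have h2 := h ψ hψ
  rw [hd, hφ.integral_sub_const_mul_smul hη _ hf, sub_eq_zero] at h2
  rw [h2, integral_smul_const]

end DuBoisReymond

/-! ### Representatives of Sobolev functions and regularity -/

section Representative

variable {H : Type*} [NormedAddCommGroup H] [InnerProductSpace ℂ H] [CompleteSpace H] {a b : ℝ}

/-- Continuity determines the representative up to the endpoints, so boundary values can be computed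
from any representative continuous on `[a, b]`, whatever choice defines `contRep`. -/
theorem contRep_eqOn {u : H1 a b H} {f : ℝ → H} (hab : a < b)
    (h : (u : L2 a b H) =ᵐ[volume.restrict (Ioo a b)] f) (hf : ContinuousOn f (Icc a b)) :
    EqOn (contRep u) f (Icc a b) :=
  eqOn_Icc_of_ae_eq_Ioo hab ((ae_eq_contRep u).symm.trans h) (continuousOn_contRep u) hf

theorem IsTest.integral_smul_primitive {φ : ℝ → ℝ} (hφ : IsTest a b φ) (hab : a < b)
    {F f : ℝ → H} (h : IsPrimitive a b F f) :
    -∫ t in Ioo a b, deriv φ t • F t = ∫ t in Ioo a b, φ t • f t := by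
  have h1 := (IsPrimitive.of_contDiff (a := a) (b := b)
    (hφ.1.of_le (by exact_mod_cast le_top))).integral_bilin
    (ContinuousLinearMap.lsmul ℝ ℝ : ℝ →L[ℝ] H →L[ℝ] H) hab.le h
  simp only [ContinuousLinearMap.lsmul_apply, hφ.eq_zero (t := a) (by simp),
    hφ.eq_zero (t := b) (by simp), zero_smul, sub_zero] at h1
  exact neg_eq_of_add_eq_zero_right h1

theorem hasWeakDeriv_of_isPrimitive {u v : L2 a b H} {F f : ℝ → H} (hab : a < b)
    (h : IsPrimitive a b F f) (hu : u =ᵐ[volume.restrict (Ioo a b)] F)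
    (hv : v =ᵐ[volume.restrict (Ioo a b)] f) : HasWeakDeriv u v := by
  intro φ hφ
  have e1 : ∫ t in Ioo a b, deriv φ t • u t = ∫ t in Ioo a b, deriv φ t • F t := by
    refine integral_congr_ae ?_
    filter_upwards [hu] with t ht
    rw [ht]
  have e2 : ∫ t in Ioo a b, φ t • v t = ∫ t in Ioo a b, φ t • f t := by
    refine integral_congr_ae ?_
    filter_upwards [hv] with t ht
    rw [ht]
  rw [e1, e2, hφ.integral_smul_primitive hab h]

/-- An `H¹` function is the primitive of its weak derivative. -/
theorem isPrimitive_contRep (hab : a < b) (u : H1 a b H) :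
    IsPrimitive a b (contRep u) (weakDeriv u) := by
  have hv : IntegrableOn (weakDeriv u) (Ioo a b) := integrable_L2 _
  have hF := isPrimitive_const_add (0 : H) hv
  have hFi : IntegrableOn (fun t => 0 + ∫ s in a..t, weakDeriv u s) (Ioo a b) :=
    (hF.continuousOn.integrableOn_compact isCompact_Icc).mono_set Ioo_subset_Icc_self
  have hu : IntegrableOn (u : L2 a b H) (Ioo a b) := integrable_L2 _
  -- Subtracting from `u` the primitive of `u'` leaves a function with weak derivative zero.
  obtain ⟨c, hc⟩ := exists_ae_eq_const_of_forall_integral_deriv_smul_eq_zero hab (hu.sub hFi)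
    fun φ hφ => by
      simp only [Pi.sub_apply, smul_sub]
      rw [integral_sub (hφ.derivative.integrable_smul_integrable hu)
        (hφ.derivative.integrable_smul_integrable hFi), ← neg_inj, neg_sub',
        hφ.integral_smul_primitive hab hF, hasWeakDeriv_weakDeriv u φ hφ]
      simp
  have hc' : (u : L2 a b H) =ᵐ[volume.restrict (Ioo a b)]
      fun t => c + ∫ s in a..t, weakDeriv u s := by
    filter_upwards [hc] with t ht
    rw [← ht]
    simp
  have hP := isPrimitive_const_add c hv
  exact hP.congr (contRep_eqOn hab hc' hP.continuousOn) .rfl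

/-- The passage from classical calculus to `H²`: primitives yield weak derivatives, and uniqueness
identifies them with the chosen ones. -/
theorem exists_mem_H2_of_isPrimitive (hab : a < b) {u g : L2 a b H} {U W f : ℝ → H}
    (hU : IsPrimitive a b U W) (hW : IsPrimitive a b W f)
    (hu : u =ᵐ[volume.restrict (Ioo a b)] U) (hg : g =ᵐ[volume.restrict (Ioo a b)] f) :
    ∃ h : u ∈ H2 a b H, secondDeriv ⟨u, h⟩ = g ∧ EqOn (val ⟨u, h⟩) U (Icc a b) ∧
      EqOn (derivVal ⟨u, h⟩) W (Icc a b) := by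
  let w : L2 a b H := (memLp_of_continuousOn_Icc hW.continuousOn).toLp W
  have hw : w =ᵐ[volume.restrict (Ioo a b)] W := MemLp.coeFn_toLp _
  have h1 : HasWeakDeriv u w := hasWeakDeriv_of_isPrimitive hab hU hu hw
  have h2 : HasWeakDeriv w g := hasWeakDeriv_of_isPrimitive hab hW hw hg
  have hu1 : u ∈ H1 a b H := ⟨w, h1⟩
  have hw1 : w ∈ H1 a b H := ⟨g, h2⟩
  have e1 : weakDeriv ⟨u, hu1⟩ = w := (hasWeakDeriv_weakDeriv ⟨u, hu1⟩).unique h1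
  have h : u ∈ H2 a b H := mem_H2_iff.2 ⟨hu1, by rwa [e1]⟩
  have e2 : derivH2 ⟨u, h⟩ = ⟨w, hw1⟩ := Subtype.ext e1
  refine ⟨h, ?_, contRep_eqOn hab hu hU.continuousOn, ?_⟩
  · exact (congrArg weakDeriv e2).trans ((hasWeakDeriv_weakDeriv ⟨w, hw1⟩).unique h2)
  · unfold derivVal
    rw [e2]
    exact contRep_eqOn hab hw hW.continuousOn

theorem isPrimitive_val (hab : a < b) (v : H2 a b H) : IsPrimitive a b (val v) (derivVal v) :=
  (isPrimitive_contRep hab (Submodule.inclusion H2_le_H1 v)).congr (fun _ _ => rfl)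
    (ae_eq_contRep (derivH2 v)).symm

theorem isPrimitive_derivVal (hab : a < b) (v : H2 a b H) :
    IsPrimitive a b (derivVal v) (secondDeriv v) :=
  isPrimitive_contRep hab (derivH2 v)

theorem ae_eq_val (v : H2 a b H) : (v : L2 a b H) =ᵐ[volume.restrict (Ioo a b)] val v :=
  ae_eq_contRep (Submodule.inclusion H2_le_H1 v)

/-- A function with a second distributional derivative in `L²` belongs to `H²`. -/
theorem exists_mem_H2_of_forall_integral_eq (hab : a < b) {u f : L2 a b H}
    (h : ∀ φ : ℝ → ℝ, IsTest a b φ →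
      ∫ t in Ioo a b, deriv (deriv φ) t • u t = ∫ t in Ioo a b, φ t • f t) :
    ∃ hu : u ∈ H2 a b H, secondDeriv ⟨u, hu⟩ = f := by
  obtain ⟨η, hη, h1⟩ := exists_isTest_integral_eq_one hab
  have hui : IntegrableOn u (Ioo a b) := integrable_L2 _
  have hF := isPrimitive_const_add (0 : H) (integrable_L2 f)
  set F : ℝ → H := fun t => 0 + ∫ s in a..t, f s with hFdef
  have hFi : IntegrableOn F (Ioo a b) :=
    (hF.continuousOn.integrableOn_compact isCompact_Icc).mono_set Ioo_subset_Icc_self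
  -- The candidate for `u'` is `F - c`. Testing it against `η`, which has integral one, forces `-∫
  -- η' u = ∫ η F - c`, and this fixes `c`.
  set c : H := (∫ t in Ioo a b, deriv η t • u t) + ∫ t in Ioo a b, η t • F t with hc
  have hP := isPrimitive_const_add (-c) (integrable_L2 f)
  have hFc : ∀ t, -c + ∫ s in a..t, f s = F t - c := fun t => by simp [hFdef]; abel
  simp only [hFc] at hP
  let w : L2 a b H := (memLp_of_continuousOn_Icc hP.continuousOn).toLp _
  have hw : w =ᵐ[volume.restrict (Ioo a b)] fun t => F t - c := MemLp.coeFn_toLp _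
  have hweak : HasWeakDeriv u w := by
    intro φ hφ
    have e1 : ∫ t in Ioo a b, φ t • w t
        = (∫ t in Ioo a b, φ t • F t) - (∫ t in Ioo a b, φ t) • c := by
      rw [← integral_smul_const, ← integral_sub (hφ.integrable_smul_integrable hFi)
        (hφ.integrableOn.smul_const c)]
      refine integral_congr_ae ?_
      filter_upwards [hw] with t ht
      rw [ht, smul_sub]
    -- Since `φ - mη = ψ'`, the hypothesis applied to `ψ` is the weak derivative identity for `φ -
    -- mη`; the choice of `c` settles it for `η`.
    obtain ⟨ψ, hψ, hd⟩ := hφ.exists_deriv_eq_sub hab hη h1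
    set m := ∫ t in Ioo a b, φ t with hm
    have hdd : deriv (deriv ψ) = fun t => deriv φ t - m * deriv η t := by
      ext t
      rw [hd, deriv_fun_sub (hφ.1.differentiable (by simp) t)
        ((hη.1.differentiable (by simp) t).const_mul m),
        deriv_const_mul _ (hη.1.differentiable (by simp) t)]
    have h2 := h ψ hψ
    rw [← hψ.integral_smul_primitive hab hF, hdd, hd] at h2
    rw [hφ.derivative.integral_sub_const_mul_smul hη.derivative m hui,
      hφ.integral_sub_const_mul_smul hη m hFi] at h2
    rw [e1, hc, smul_add, sub_eq_iff_eq_add.1 h2]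
    abel
  have hu1 : u ∈ H1 a b H := ⟨w, hweak⟩
  have e1 : weakDeriv ⟨u, hu1⟩ = w := (hasWeakDeriv_weakDeriv ⟨u, hu1⟩).unique hweak
  have h3 := isPrimitive_contRep hab ⟨u, hu1⟩
  rw [e1] at h3
  obtain ⟨h4, h5, -⟩ := exists_mem_H2_of_isPrimitive hab
    (h3.congr (fun _ _ => rfl) hw.symm) hP (ae_eq_contRep ⟨u, hu1⟩) (.rfl : f =ᵐ[_] f)
  exact ⟨h4, h5⟩

end Representative

section BoundaryForms

/-! ### Vector-valued test functions -/

section TensorTest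

variable {H : Type*} [NormedAddCommGroup H] [InnerProductSpace ℂ H] {a b : ℝ}

theorem inner_testToL2 (φ : testSpace a b H) (u : L2 a b H) :
    inner ℂ (testToL2 φ) u = ∫ t in Ioo a b, inner ℂ (φ.1 t) (u t) := by
  rw [L2.inner_def]
  refine integral_congr_ae ?_
  filter_upwards [MemLp.coeFn_toLp (IsTest.memLp φ.2 2)] with t ht
  exact congrArg (fun x => inner ℂ x (u t)) ht

/-- The test function `t ↦ φ(t) x`. -/
def tensorTest {φ : ℝ → ℝ} (hφ : IsTest a b φ) (x : H) : testSpace a b H :=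
  ⟨fun t => φ t • x, hφ.1.smul contDiff_const, hφ.2.1.smul_right,
    (closure_mono (Function.support_smul_subset_left φ fun _ => x)).trans hφ.2.2⟩

theorem testSecondDeriv_tensorTest {φ : ℝ → ℝ} (hφ : IsTest a b φ) (x : H) :
    testSecondDeriv (tensorTest hφ x) = tensorTest hφ.derivative.derivative x := by
  have key : ∀ {φ : ℝ → ℝ}, IsTest a b φ → deriv (fun t => φ t • x) = fun t => deriv φ t • x :=
    fun hφ => funext fun t => deriv_smul_const (hφ.1.differentiable (by simp) t) x
  refine Subtype.ext ?_
  change deriv (deriv fun t => φ t • x) = fun t => deriv (deriv φ) t • x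
  rw [key hφ, key hφ.derivative]

end TensorTest

variable {H : Type*} [NormedAddCommGroup H] [InnerProductSpace ℂ H] [CompleteSpace H] {a b : ℝ}

/-! ### Green's formula -/

section Green

/-- The inner product as a real bilinear map. -/
def innerRealBilin (H : Type*) [NormedAddCommGroup H] [InnerProductSpace ℂ H] :
    H →L[ℝ] H →L[ℝ] ℂ :=
  (isBoundedBilinearMap_inner (𝕜 := ℂ) (E := H)).toContinuousLinearMap

theorem innerRealBilin_apply {H : Type*} [NormedAddCommGroup H] [InnerProductSpace ℂ H]
    (x y : H) : innerRealBilin H x y = inner ℂ x y := rfl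

/-- Integrating each term by parts once produces the same integral of `⟨v', w'⟩`, which cancels. -/
theorem inner_secondDeriv_sub (hab : a < b) (v w : H2 a b H) :
    inner ℂ (secondDeriv v) (w : L2 a b H) - inner ℂ (v : L2 a b H) (secondDeriv w)
      = (inner ℂ (derivVal v b) (val w b) - inner ℂ (derivVal v a) (val w a))
        - (inner ℂ (val v b) (derivVal w b) - inner ℂ (val v a) (derivVal w a)) := by
  have h1 := (isPrimitive_derivVal hab v).integral_bilin (innerRealBilin H) hab.le
    (isPrimitive_val hab w)
  have h2 := (isPrimitive_val hab v).integral_bilin (innerRealBilin H) hab.le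
    (isPrimitive_derivVal hab w)
  simp only [innerRealBilin_apply] at h1 h2
  have e1 : inner ℂ (secondDeriv v) (w : L2 a b H)
      = ∫ t in Ioo a b, inner ℂ (secondDeriv v t) (val w t) := by
    rw [L2.inner_def]
    refine integral_congr_ae ?_
    filter_upwards [ae_eq_val w] with t ht
    rw [ht]
  have e2 : inner ℂ (v : L2 a b H) (secondDeriv w)
      = ∫ t in Ioo a b, inner ℂ (val v t) (secondDeriv w t) := by
    rw [L2.inner_def]
    refine integral_congr_ae ?_
    filter_upwards [ae_eq_val v] with t ht
    rw [ht]
  rw [e1, e2, ← h1, ← h2]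
  ring

/-- Green's formula in terms of the boundary maps. -/
theorem inner_Γp_sub_inner_Γm (hab : a < b) (v w : H2 a b H) :
    inner ℂ (Γp v) (Γp w) - inner ℂ (Γm v) (Γm w)
      = Complex.I * (inner ℂ (secondDeriv v) (w : L2 a b H)
        - inner ℂ (v : L2 a b H) (secondDeriv w)) := by
  have h2 : ((√2 / 2 : ℝ) : ℂ) * ((√2 / 2 : ℝ) : ℂ) = 1 / 2 := by
    rw [← Complex.ofReal_mul, div_mul_div_comm, Real.mul_self_sqrt (by norm_num)]
    norm_num
  rw [inner_secondDeriv_sub hab]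
  simp only [Γp, Γm, inner_smul_left, inner_smul_right, WithLp.prod_inner_apply, inner_add_left,
    inner_add_right, inner_sub_left, inner_sub_right, Complex.conj_I, Complex.conj_ofReal,
    ← mul_assoc, h2]
  linear_combination (0 : ℂ) * h2

theorem re_inner_self {K : Type*} [NormedAddCommGroup K] [InnerProductSpace ℂ K] (x : K) :
    (inner ℂ x x).re = ‖x‖ ^ 2 :=
  (norm_sq_eq_re_inner (𝕜 := ℂ) x).symm

/-- The diagonal of Green's formula. It turns dissipativity into a comparison of two boundary norms.
-/
theorem re_inner_I_smul_secondDeriv (hab : a < b) (v : H2 a b H) :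
    (inner ℂ (Complex.I • secondDeriv v) (v : L2 a b H)).re
      = (‖Γm v‖ ^ 2 - ‖Γp v‖ ^ 2) / 2 := by
  have h := congrArg Complex.re (inner_Γp_sub_inner_Γm hab v v)
  rw [inner_smul_left]
  have h' : (inner ℂ (v : L2 a b H) (secondDeriv v)).im
      = -(inner ℂ (secondDeriv v) (v : L2 a b H)).im := by
    rw [← inner_conj_symm, Complex.conj_im]
  rw [Complex.sub_re, re_inner_self, re_inner_self] at h
  simp only [Complex.mul_re, Complex.I_re, Complex.I_im, Complex.sub_im, Complex.conj_I,
    Complex.neg_re, Complex.neg_im] at h ⊢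
  linarith

end Green

/-! ### Linearity and joint surjectivity of the boundary maps -/

section BoundaryMaps

/-- Representatives are chosen separately for each function, so additivity comes from their
uniqueness and is available only on `[a, b]`. -/
theorem contRep_add (hab : a < b) (u v : H1 a b H) {t : ℝ} (ht : t ∈ Icc a b) :
    contRep (u + v) t = contRep u t + contRep v t := by
  refine contRep_eqOn (f := fun t => contRep u t + contRep v t) hab ?_
    ((continuousOn_contRep u).add (continuousOn_contRep v)) ht
  filter_upwards [Lp.coeFn_add (u : L2 a b H) v, ae_eq_contRep u, ae_eq_contRep v] with s h1 h2 h3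
  rw [Submodule.coe_add, h1, Pi.add_apply, h2, h3]

theorem contRep_smul (hab : a < b) (c : ℂ) (u : H1 a b H) {t : ℝ} (ht : t ∈ Icc a b) :
    contRep (c • u) t = c • contRep u t := by
  refine contRep_eqOn (f := fun t => c • contRep u t) hab ?_
    ((continuousOn_contRep u).const_smul c) ht
  filter_upwards [Lp.coeFn_smul c (u : L2 a b H), ae_eq_contRep u] with s h1 h2
  rw [Submodule.coe_smul, h1, Pi.smul_apply, h2]

theorem val_add (hab : a < b) (u v : H2 a b H) {t : ℝ} (ht : t ∈ Icc a b) :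
    val (u + v) t = val u t + val v t := by
  rw [val, map_add, contRep_add hab _ _ ht, val, val]

theorem val_smul (hab : a < b) (c : ℂ) (u : H2 a b H) {t : ℝ} (ht : t ∈ Icc a b) :
    val (c • u) t = c • val u t := by
  rw [val, map_smul, contRep_smul hab _ _ ht, val]

theorem derivVal_add (hab : a < b) (u v : H2 a b H) {t : ℝ} (ht : t ∈ Icc a b) :
    derivVal (u + v) t = derivVal u t + derivVal v t := by
  rw [derivVal, map_add, contRep_add hab _ _ ht, derivVal, derivVal]

theorem derivVal_smul (hab : a < b) (c : ℂ) (u : H2 a b H) {t : ℝ} (ht : t ∈ Icc a b) :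
    derivVal (c • u) t = c • derivVal u t := by
  rw [derivVal, map_smul, contRep_smul hab _ _ ht, derivVal]

/-- `Γ₋` as a linear map. -/
def ΓmLin (H : Type*) [NormedAddCommGroup H] [InnerProductSpace ℂ H] [CompleteSpace H]
    (hab : a < b) : H2 a b H →ₗ[ℂ] WithLp 2 (H × H) where
  toFun := Γm
  map_add' u v := by
    have ha : a ∈ Icc a b := ⟨le_rfl, hab.le⟩
    have hb : b ∈ Icc a b := ⟨hab.le, le_rfl⟩
    simp only [Γm, val_add hab _ _ ha, val_add hab _ _ hb, derivVal_add hab _ _ ha,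
      derivVal_add hab _ _ hb]
    rw [← smul_add, ← WithLp.toLp_add, Prod.mk_add_mk]
    congr 3 <;> module
  map_smul' c u := by
    have ha : a ∈ Icc a b := ⟨le_rfl, hab.le⟩
    have hb : b ∈ Icc a b := ⟨hab.le, le_rfl⟩
    simp only [Γm, val_smul hab _ _ ha, val_smul hab _ _ hb, derivVal_smul hab _ _ ha,
      derivVal_smul hab _ _ hb, RingHom.id_apply]
    simp only [← WithLp.toLp_smul, Prod.smul_mk]
    congr 2 <;> module

/-- `Γ₊` as a linear map. -/
def ΓpLin (H : Type*) [NormedAddCommGroup H] [InnerProductSpace ℂ H] [CompleteSpace H]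
    (hab : a < b) : H2 a b H →ₗ[ℂ] WithLp 2 (H × H) where
  toFun := Γp
  map_add' u v := by
    have ha : a ∈ Icc a b := ⟨le_rfl, hab.le⟩
    have hb : b ∈ Icc a b := ⟨hab.le, le_rfl⟩
    simp only [Γp, val_add hab _ _ ha, val_add hab _ _ hb, derivVal_add hab _ _ ha,
      derivVal_add hab _ _ hb]
    rw [← smul_add, ← WithLp.toLp_add, Prod.mk_add_mk]
    congr 3 <;> module
  map_smul' c u := by
    have ha : a ∈ Icc a b := ⟨le_rfl, hab.le⟩
    have hb : b ∈ Icc a b := ⟨hab.le, le_rfl⟩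
    simp only [Γp, val_smul hab _ _ ha, val_smul hab _ _ hb, derivVal_smul hab _ _ ha,
      derivVal_smul hab _ _ hb, RingHom.id_apply]
    simp only [← WithLp.toLp_smul, Prod.smul_mk]
    congr 2 <;> module

theorem ΓmLin_apply (hab : a < b) (v : H2 a b H) : ΓmLin H hab v = Γm v := rfl

theorem ΓpLin_apply (hab : a < b) (v : H2 a b H) : ΓpLin H hab v = Γp v := rfl

/-- A `C²` function belongs to `H²`. -/
theorem exists_mem_H2_of_contDiff (hab : a < b) {f : ℝ → H} (hf : ContDiff ℝ 2 f)
    {u g : L2 a b H} (hu : u =ᵐ[volume.restrict (Ioo a b)] f)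
    (hg : g =ᵐ[volume.restrict (Ioo a b)] deriv (deriv f)) :
    ∃ h : u ∈ H2 a b H, secondDeriv ⟨u, h⟩ = g ∧ EqOn (val ⟨u, h⟩) f (Icc a b) ∧
      EqOn (derivVal ⟨u, h⟩) (deriv f) (Icc a b) := by
  have hf' : ContDiff ℝ 1 (deriv f) := by
    have : ContDiff ℝ (1 + 1) f := by norm_num; exact hf
    exact (contDiff_succ_iff_deriv.1 this).2.2
  exact exists_mem_H2_of_isPrimitive hab (IsPrimitive.of_contDiff (hf.of_le (by norm_num)))
    (IsPrimitive.of_contDiff hf') hu hg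

/-- Cubic Hermite interpolation of boundary values. -/
theorem exists_val_derivVal_eq (hab : a < b) (p₀ p₁ q₀ q₁ : H) :
    ∃ v : H2 a b H, val v a = p₀ ∧ derivVal v a = p₁ ∧ val v b = q₀ ∧ derivVal v b = q₁ := by
  set L := b - a with hL
  have hL0 : L ≠ 0 := sub_ne_zero.2 hab.ne'
  set A := q₀ - p₀ - L • p₁ with hA
  set B := q₁ - p₁ with hB
  -- `A` and `B` are the errors in value and slope at `b` of the affine part. The last two
  -- coefficients solve `αL² + βL³ = A`, `2αL + 3βL² = B`.
  let f : ℝ → H := fun t => p₀ + (t - a) • p₁ + (t - a) ^ 2 • ((L ^ 2)⁻¹ • ((3 : ℝ) • A - L • B))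
    + (t - a) ^ 3 • ((L ^ 3)⁻¹ • (L • B - (2 : ℝ) • A))
  have hf : ContDiff ℝ 2 f := by fun_prop
  have hd : ∀ t, HasDerivAt f (p₁ + (2 * (t - a)) • ((L ^ 2)⁻¹ • ((3 : ℝ) • A - L • B))
      + (3 * (t - a) ^ 2) • ((L ^ 3)⁻¹ • (L • B - (2 : ℝ) • A))) t := by
    intro t
    have h0 : HasDerivAt (fun t : ℝ => t - a) 1 t := (hasDerivAt_id t).sub_const a
    convert (((h0.smul_const p₁).const_add p₀).add
      ((h0.pow 2).smul_const ((L ^ 2)⁻¹ • ((3 : ℝ) • A - L • B)))).add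
      ((h0.pow 3).smul_const ((L ^ 3)⁻¹ • (L • B - (2 : ℝ) • A))) using 1 <;> norm_num
    rfl
  have hf' : Continuous (deriv (deriv f)) := by
    have : ContDiff ℝ (1 + 1) f := by norm_num; exact hf
    exact (contDiff_succ_iff_deriv.1 this).2.2.continuous_deriv le_rfl
  obtain ⟨h, -, h1, h2⟩ := exists_mem_H2_of_contDiff hab hf
    (MemLp.coeFn_toLp (memLp_of_continuousOn_Icc (a := a) (b := b) hf.continuous.continuousOn))
    (MemLp.coeFn_toLp (memLp_of_continuousOn_Icc (a := a) (b := b) hf'.continuousOn))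
  have ha : a ∈ Icc a b := ⟨le_rfl, hab.le⟩
  have hb : b ∈ Icc a b := ⟨hab.le, le_rfl⟩
  refine ⟨⟨_, h⟩, ?_, ?_, ?_, ?_⟩
  · rw [h1 ha]
    simp [f]
  · rw [h2 ha, (hd a).deriv]
    simp
  · rw [h1 hb]
    simp only [f, ← hL, hA]
    match_scalars <;> field_simp <;> ring
  · rw [h2 hb, (hd b).deriv]
    simp only [← hL, hA, hB]
    match_scalars <;> field_simp <;> ring

/-- The boundary maps are jointly surjective. -/
theorem exists_Γm_Γp_eq (hab : a < b) (x y : WithLp 2 (H × H)) :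
    ∃ v : H2 a b H, Γm v = x ∧ Γp v = y := by
  set c : ℂ := ((√2 / 2 : ℝ) : ℂ) with hc
  have hcc : c * c = 1 / 2 := by
    rw [hc, ← Complex.ofReal_mul, div_mul_div_comm, Real.mul_self_sqrt (by norm_num)]
    norm_num
  -- Sums and differences of `Γ₋` and `Γ₊` isolate `v` and `v'` at each endpoint; as `2c² = 1`,
  -- dividing by `2c` is multiplying by `c`. The sign of `v'` flips at `b`.
  obtain ⟨v, h1, h2, h3, h4⟩ := exists_val_derivVal_eq hab (c • (x.fst + y.fst))
    ((c * Complex.I) • (x.fst - y.fst)) (c • (x.snd + y.snd))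
    ((c * Complex.I) • (y.snd - x.snd))
  refine ⟨v, ?_, ?_⟩ <;>
  · simp only [Γm, Γp, h1, h2, h3, h4, ← hc, ← WithLp.toLp_smul, Prod.smul_mk]
    refine (WithLp.ofLp_injective 2) (Prod.ext ?_ ?_) <;>
    · simp only [WithLp.ofLp_fst, WithLp.ofLp_snd]
      match_scalars <;> first
        | linear_combination (1 - Complex.I ^ 2) * hcc - (1 / 2) * Complex.I_mul_I
        | linear_combination (1 + Complex.I ^ 2) * hcc + (1 / 2) * Complex.I_mul_I

end BoundaryMaps

/-! ### The adjoint of `S` -/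

section Adjoint

/-- Links `D(S)`, made of vector-valued functions, with weak derivatives, tested against real ones:
letting `x` vary recovers the vector integral. -/
theorem inner_testToL2_tensorTest {φ : ℝ → ℝ} (hφ : IsTest a b φ) (x : H) (u : L2 a b H) :
    inner ℂ (testToL2 (tensorTest hφ x)) u = inner ℂ x (∫ t in Ioo a b, φ t • u t) := by
  rw [inner_testToL2, ← integral_inner (hφ.integrable_smul u)]
  refine integral_congr_ae (Filter.Eventually.of_forall fun t => ?_)
  simp only [tensorTest]
  rw [← Complex.coe_smul, ← Complex.coe_smul, inner_smul_left, inner_smul_right,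
    Complex.conj_ofReal]

/-- The adjoint of `S` is the second derivative on `H²`. -/
theorem exists_mem_H2_of_forall_inner_eq (hab : a < b) {u f : L2 a b H}
    (h : ∀ φ : testSpace a b H,
      inner ℂ (testToL2 (testSecondDeriv φ)) u = inner ℂ (testToL2 φ) f) :
    ∃ hu : u ∈ H2 a b H, secondDeriv ⟨u, hu⟩ = f := by
  refine exists_mem_H2_of_forall_integral_eq hab fun φ hφ => ext_inner_left ℂ fun x => ?_
  rw [← inner_testToL2_tensorTest hφ.derivative.derivative, ← inner_testToL2_tensorTest hφ,
    ← testSecondDeriv_tensorTest, h]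

theorem dense_domain_S : Dense ((S a b H).domain : Set (L2 a b H)) := by
  rw [Submodule.dense_iff_topologicalClosure_eq_top, Submodule.topologicalClosure_eq_top_iff,
    Submodule.eq_bot_iff]
  intro u hu
  rw [Submodule.mem_orthogonal] at hu
  refine Lp.ext ((ae_eq_of_forall_integral_smul_eq (integrable_L2 u) (integrable_L2 0)
    fun φ hφ => ?_))
  refine ext_inner_left ℂ fun x => ?_
  rw [← inner_testToL2_tensorTest hφ, ← inner_testToL2_tensorTest hφ, inner_zero_right]
  exact hu _ (LinearMap.mem_range_self _ _)

theorem testToL2_mem_H2 (hab : a < b) (φ : testSpace a b H) :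
    ∃ h : testToL2 φ ∈ H2 a b H, secondDeriv ⟨_, h⟩ = testToL2 (testSecondDeriv φ) ∧
      Γm ⟨_, h⟩ = 0 ∧ Γp ⟨_, h⟩ = 0 := by
  obtain ⟨h, h1, h2, h3⟩ := exists_mem_H2_of_contDiff hab
    (contDiff_infty.1 φ.2.1 2)
    (MemLp.coeFn_toLp (IsTest.memLp φ.2 2))
    (MemLp.coeFn_toLp (IsTest.memLp (testSecondDeriv φ).2 2))
  have ha : a ∈ Icc a b := ⟨le_rfl, hab.le⟩
  have hb : b ∈ Icc a b := ⟨hab.le, le_rfl⟩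
  have e1 := h2 ha
  have e2 := h2 hb
  have e3 := h3 ha
  have e4 := h3 hb
  rw [IsTest.eq_zero φ.2 (by simp)] at e1 e2
  rw [IsTest.eq_zero (IsTest.derivative φ.2) (by simp)] at e3 e4
  refine ⟨h, h1, ?_, ?_⟩
  · change (_ : ℂ) • WithLp.toLp 2 (val ⟨_, h⟩ a - _ • derivVal ⟨_, h⟩ a,
      val ⟨_, h⟩ b + _ • derivVal ⟨_, h⟩ b) = 0
    erw [e1, e2, e3, e4]
    simp
  · change (_ : ℂ) • WithLp.toLp 2 (val ⟨_, h⟩ a + _ • derivVal ⟨_, h⟩ a,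
      val ⟨_, h⟩ b - _ • derivVal ⟨_, h⟩ b) = 0
    erw [e1, e2, e3, e4]
    simp

end Adjoint

end BoundaryForms

/-! ### Extending contractions and isometries -/

section Extension

variable {D K : Type*} [AddCommGroup D] [Module ℂ D] [NormedAddCommGroup K]
  [InnerProductSpace ℂ K] [CompleteSpace K]

/-- A contraction between subspaces extends to a contraction on the whole Hilbert space. -/
theorem exists_contraction_extension (p q : D →ₗ[ℂ] K) (h : ∀ w, ‖q w‖ ≤ ‖p w‖) :
    ∃ Φ : K →L[ℂ] K, (∀ x, ‖Φ x‖ ≤ ‖x‖) ∧ ∀ w, Φ (p w) = q w := by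
  let R := (LinearMap.range p).topologicalClosure
  have hR : CompleteSpace R := (Submodule.isClosed_topologicalClosure _).completeSpace_coe
  have hmem : ∀ w, p w ∈ R := fun w =>
    Submodule.le_topologicalClosure _ (LinearMap.mem_range_self p w)
  let e : D →ₗ[ℂ] R := p.codRestrict R hmem
  have he : DenseRange e := by
    intro x
    rw [closure_subtype]
    have hx : (x : K) ∈ closure (LinearMap.range p : Set K) := x.2
    refine closure_mono ?_ hx
    rintro _ ⟨w, rfl⟩
    exact ⟨e w, ⟨w, rfl⟩, rfl⟩
  have hn : ∀ w, ‖q w‖ ≤ 1 * ‖e w‖ := fun w => by rw [one_mul]; exact h w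
  -- Extend by continuity to the closure of the range of `p`, and by zero on its orthogonal
  -- complement.
  refine ⟨(q.extendOfNorm e).comp R.orthogonalProjectionOnto, fun x => ?_, fun w => ?_⟩
  · refine (LinearMap.norm_extendOfNorm_apply_le he 1 hn _).trans ?_
    rw [one_mul]
    exact R.norm_orthogonalProjectionOnto_apply_le x
  · have h1 : R.orthogonalProjectionOnto (p w) = e w :=
      Submodule.orthogonalProjectionOnto_mem_subspace_eq_self (e w)
    rw [ContinuousLinearMap.comp_apply, h1]
    exact LinearMap.extendOfNorm_eq he ⟨1, hn⟩ w

/-- An isometry between dense subspaces extends to a unitary operator. -/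
theorem exists_unitary_extension (p q : D →ₗ[ℂ] K) (hp : DenseRange p) (hq : DenseRange q)
    (h : ∀ w, ‖q w‖ = ‖p w‖) :
    ∃ Φ ∈ unitary (K →L[ℂ] K), ∀ w, Φ (p w) = q w := by
  let Ψ : K ≃ₗᵢ[ℂ] K := (LinearEquiv.refl ℂ D).extendOfIsometry p q hp hq h
  refine ⟨(Unitary.linearIsometryEquiv.symm Ψ : unitary (K →L[ℂ] K)), Subtype.prop _, fun w => ?_⟩
  exact LinearMap.extendOfNorm_eq hp ⟨1, fun x => by simp [h]⟩ w

end Extension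

/-! ### Selfadjoint and dissipative operators in Hilbert space -/

section Abstract

variable {V : Type*} [NormedAddCommGroup V] [InnerProductSpace ℂ V]

/-- This is equality of the graphs of `T` and its adjoint. One direction of the inner equivalence is
maximality, the other symmetry. -/
theorem isSelfAdjoint_iff_forall [CompleteSpace V] {T : V →ₗ.[ℂ] V}
    (hd : Dense (T.domain : Set V)) :
    IsSelfAdjoint T ↔ ∀ u f : V, (∀ x : T.domain, inner ℂ (T x) u = inner ℂ (x : V) f) ↔
      ∃ hu : u ∈ T.domain, T ⟨u, hu⟩ = f := by
  have key : ∀ u f : V, (u, f) ∈ T.adjoint.graph ↔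
      ∀ x : T.domain, inner ℂ (T x) u = inner ℂ (x : V) f := by
    intro u f
    rw [LinearPMap.adjoint_graph_eq_graph_adjoint hd, Submodule.mem_adjoint_iff]
    simp only [LinearPMap.mem_graph_iff, sub_eq_zero]
    constructor
    · intro h x
      exact h _ _ ⟨x, rfl, rfl⟩
    · rintro h _ _ ⟨x, rfl, rfl⟩
      exact h x
  have key' : ∀ u f : V, (u, f) ∈ T.graph ↔ ∃ hu : u ∈ T.domain, T ⟨u, hu⟩ = f := by
    intro u f
    rw [LinearPMap.mem_graph_iff]
    constructor
    · rintro ⟨x, rfl, rfl⟩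
      exact ⟨x.2, rfl⟩
    · rintro ⟨hu, rfl⟩
      exact ⟨⟨u, hu⟩, rfl, rfl⟩
  simp only [← key, ← key', LinearPMap.isSelfAdjoint_def]
  exact ⟨fun h u f => by rw [h], fun h => LinearPMap.eq_of_eq_graph (Submodule.ext fun x => h _ _)⟩

theorem eq_zero_of_forall_add_re_mul_nonpos {r : ℝ} {z : ℂ} (h : ∀ c : ℂ, r + (c * z).re ≤ 0) :
    z = 0 := by
  by_contra hz
  -- With this `c` the expression equals `1`.
  have h1 := h (((1 - r : ℝ) : ℂ) * z⁻¹)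
  rw [mul_assoc, inv_mul_cancel₀ hz, mul_one, Complex.ofReal_re] at h1
  linarith

/-- A dissipative operator is skew-symmetric against vectors at which its form vanishes. -/
theorem inner_add_inner_eq_zero_of_dissipative {A : V →ₗ.[ℂ] V}
    (hA : ∀ x : A.domain, (inner ℂ (A x) (x : V)).re ≤ 0) (x y : A.domain)
    (hy : (inner ℂ (A y) (y : V)).re = 0) :
    inner ℂ (A x) (y : V) + inner ℂ (x : V) (A y) = 0 := by
  refine eq_zero_of_forall_add_re_mul_nonpos (r := (inner ℂ (A x) (x : V)).re) fun c => ?_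
  -- The term in `|c|²` has real part zero, so the form is real-affine in `c` and its slope must
  -- vanish.
  have h := hA (x + c • y)
  rw [LinearPMap.map_add, LinearPMap.map_smul, Submodule.coe_add, Submodule.coe_smul] at h
  simp only [inner_add_left, inner_add_right, inner_smul_left, inner_smul_right] at h
  rw [← inner_conj_symm (x : V) (A y)]
  have e : (c * ((starRingEnd ℂ) c * inner ℂ (A y) (y : V))).re = 0 := by
    rw [← mul_assoc, Complex.mul_conj, Complex.re_ofReal_mul, hy, mul_zero]
  simp only [Complex.add_re, Complex.mul_re, Complex.conj_re, Complex.conj_im, mul_add] at h e ⊢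
  linarith

end Abstract

section Characterization

variable {H : Type*} [NormedAddCommGroup H] [InnerProductSpace ℂ H] [CompleteSpace H] {a b : ℝ}

/-! ### The range condition under contractive boundary conditions -/

section MaximalRange

/-- Here `‖v‖² = Re ⟨iv'', v⟩ ≤ 0`. The next lemma is the counterpart for the adjoint condition,
with signs reversed. -/
theorem H2_eq_zero_of_eq_I_smul (hab : a < b) {v : H2 a b H} (h : ‖Γm v‖ ≤ ‖Γp v‖)
    (hv : (v : L2 a b H) = Complex.I • secondDeriv v) : (v : L2 a b H) = 0 := by
  have h1 := re_inner_I_smul_secondDeriv hab v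
  rw [← hv, re_inner_self] at h1
  have h2 := pow_le_pow_left₀ (norm_nonneg _) h 2
  rw [← norm_eq_zero, ← sq_eq_zero_iff]
  exact le_antisymm (by linarith) (sq_nonneg _)

theorem H2_eq_zero_of_eq_neg_I_smul (hab : a < b) {v : H2 a b H} (h : ‖Γp v‖ ≤ ‖Γm v‖)
    (hv : (v : L2 a b H) = -(Complex.I • secondDeriv v)) : (v : L2 a b H) = 0 := by
  have h1 := re_inner_I_smul_secondDeriv hab v
  rw [← neg_eq_iff_eq_neg.2 hv, inner_neg_left, Complex.neg_re, re_inner_self] at h1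
  have h2 := pow_le_pow_left₀ (norm_nonneg _) h 2
  rw [← norm_eq_zero, ← sq_eq_zero_iff]
  exact le_antisymm (by linarith) (sq_nonneg _)

/-- Dissipativity gives `‖v‖² ≤ Re ⟨v - iv'', v⟩`; Cauchy–Schwarz does the rest. -/
theorem norm_le_norm_sub_I_smul_secondDeriv (hab : a < b) {v : H2 a b H} (h : ‖Γm v‖ ≤ ‖Γp v‖) :
    ‖(v : L2 a b H)‖ ≤ ‖(v : L2 a b H) - Complex.I • secondDeriv v‖ := by
  have h1 := re_inner_I_smul_secondDeriv hab v
  have h2 := pow_le_pow_left₀ (norm_nonneg _) h 2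
  have h3 : ‖(v : L2 a b H)‖ ^ 2
      ≤ (inner ℂ ((v : L2 a b H) - Complex.I • secondDeriv v) (v : L2 a b H)).re := by
    rw [inner_sub_left, Complex.sub_re, re_inner_self, h1]
    linarith
  have h4 := h3.trans ((Complex.re_le_norm _).trans (norm_inner_le_norm _ _))
  by_contra! h5
  have h6 : 0 < ‖(v : L2 a b H)‖ := (norm_nonneg _).trans_lt h5
  nlinarith

variable (Φ : WithLp 2 (H × H) →L[ℂ] WithLp 2 (H × H))

/-- The graph of the adjoint of `w ↦ w''` with boundary condition `Γ₊ w = Φ* Γ₋ w`. -/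
def boundaryGraph (a b : ℝ) : Submodule ℂ (L2 a b H × L2 a b H) where
  carrier := {p | ∀ w : H2 a b H, Γp w = ContinuousLinearMap.adjoint Φ (Γm w) →
    inner ℂ (secondDeriv w) p.1 = inner ℂ (w : L2 a b H) p.2}
  zero_mem' w _ := by simp
  add_mem' hp hq w hw := by
    simp only [Prod.fst_add, Prod.snd_add, inner_add_right, hp w hw, hq w hw]
  smul_mem' c p hp w hw := by
    simp only [Prod.smul_fst, Prod.smul_snd, inner_smul_right, hp w hw]

/-- Described as an adjoint, the graph is cut out by continuous equations, so no bound on boundary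
values in the graph norm is needed. -/
theorem isClosed_boundaryGraph : IsClosed (boundaryGraph Φ a b : Set (L2 a b H × L2 a b H)) := by
  have : (boundaryGraph Φ a b : Set (L2 a b H × L2 a b H))
      = ⋂ (w : H2 a b H) (_ : Γp w = ContinuousLinearMap.adjoint Φ (Γm w)),
        {p | inner ℂ (secondDeriv w) p.1 = inner ℂ (w : L2 a b H) p.2} := by
    ext p
    simp only [mem_iInter]
    rfl
  rw [this]
  exact isClosed_iInter fun w => isClosed_iInter fun _ => isClosed_eq (by fun_prop) (by fun_prop)

/-- If the boundary forms of `v` and `w` agree for all `w` with `Γ₊ w = Ψ Γ₋ w`, then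
`Γ₋ v = Ψ* Γ₊ v`. -/
theorem Γm_eq_adjoint_Γp (hab : a < b) {v : H2 a b H}
    {Ψ : WithLp 2 (H × H) →L[ℂ] WithLp 2 (H × H)}
    (h : ∀ w : H2 a b H, Γp w = Ψ (Γm w) → inner ℂ (Γp w) (Γp v) = inner ℂ (Γm w) (Γm v)) :
    Γm v = ContinuousLinearMap.adjoint Ψ (Γp v) := by
  refine ext_inner_left ℂ fun x => ?_
  obtain ⟨w, h1, h2⟩ := exists_Γm_Γp_eq hab x (Ψ x)
  rw [ContinuousLinearMap.adjoint_inner_right, ← h2, ← h1, h w (by rw [h2, h1])]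

/-- If the boundary forms of `v` and `w` agree for all `w` with `Γ₋ w = Ψ Γ₊ w`, then
`Γ₊ v = Ψ* Γ₋ v`. -/
theorem Γp_eq_adjoint_Γm (hab : a < b) {v : H2 a b H}
    {Ψ : WithLp 2 (H × H) →L[ℂ] WithLp 2 (H × H)}
    (h : ∀ w : H2 a b H, Γm w = Ψ (Γp w) → inner ℂ (Γp w) (Γp v) = inner ℂ (Γm w) (Γm v)) :
    Γp v = ContinuousLinearMap.adjoint Ψ (Γm v) := by
  refine ext_inner_left ℂ fun x => ?_
  obtain ⟨w, h1, h2⟩ := exists_Γm_Γp_eq hab (Ψ x) x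
  rw [ContinuousLinearMap.adjoint_inner_right, ← h1, ← h2, h w (by rw [h2, h1])]

theorem inner_Γp_eq_inner_Γm_iff (hab : a < b) (v w : H2 a b H) :
    inner ℂ (Γp v) (Γp w) = inner ℂ (Γm v) (Γm w) ↔
      inner ℂ (secondDeriv v) (w : L2 a b H) = inner ℂ (v : L2 a b H) (secondDeriv w) := by
  rw [← sub_eq_zero, inner_Γp_sub_inner_Γm hab, mul_eq_zero, or_iff_right Complex.I_ne_zero,
    sub_eq_zero]

/-- The conditions `Γ₊ = Φ*Γ₋` and `Γ₋ = ΦΓ₊` are adjoint to each other. Test functions satisfy the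
former trivially, which gives `H²` regularity; joint surjectivity then recovers the latter. -/
theorem mem_boundaryGraph_iff (hab : a < b) {p : L2 a b H × L2 a b H} :
    p ∈ boundaryGraph Φ a b ↔
      ∃ h : p.1 ∈ H2 a b H, Γm ⟨p.1, h⟩ = Φ (Γp ⟨p.1, h⟩) ∧ secondDeriv ⟨p.1, h⟩ = p.2 := by
  constructor
  · intro hp
    obtain ⟨h, h1⟩ := exists_mem_H2_of_forall_inner_eq (u := p.1) (f := p.2) hab fun φ => by
      obtain ⟨hφ, e1, e2, e3⟩ := testToL2_mem_H2 hab φ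
      have := hp ⟨_, hφ⟩ (by rw [e2, e3, map_zero])
      rwa [e1] at this
    refine ⟨h, ?_, h1⟩
    have := Γm_eq_adjoint_Γp hab (v := ⟨p.1, h⟩) (Ψ := ContinuousLinearMap.adjoint Φ) fun w hw => by
      rw [inner_Γp_eq_inner_Γm_iff hab, h1]
      exact hp w hw
    rwa [ContinuousLinearMap.adjoint_adjoint] at this
  · rintro ⟨h, h1, h2⟩ w hw
    rw [← h2]
    refine (inner_Γp_eq_inner_Γm_iff hab w ⟨p.1, h⟩).1 ?_
    rw [hw, h1, ContinuousLinearMap.adjoint_inner_left]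

variable {Φ}

/-- The range condition for the boundary condition `Γ₋ v = Φ Γ₊ v` with a contraction `Φ`. -/
theorem exists_sub_I_smul_secondDeriv_eq (hab : a < b) (hΦ : ∀ x, ‖Φ x‖ ≤ ‖x‖) (y : L2 a b H) :
    ∃ v : H2 a b H, Γm v = Φ (Γp v) ∧ (v : L2 a b H) - Complex.I • secondDeriv v = y := by
  let G := boundaryGraph Φ a b
  have hG : CompleteSpace G := (isClosed_boundaryGraph Φ).completeSpace_coe
  let L : G →L[ℂ] L2 a b H :=
    ContinuousLinearMap.comp (ContinuousLinearMap.fst ℂ (L2 a b H) (L2 a b H)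
      - Complex.I • ContinuousLinearMap.snd ℂ (L2 a b H) (L2 a b H)) G.subtypeL
  have hL : ∀ p : G, L p = p.1.1 - Complex.I • p.1.2 := fun p => rfl
  -- `‖v‖ ≤ ‖L p‖` gives `‖v''‖ ≤ ‖v‖ + ‖L p‖ ≤ 2‖L p‖`, and the product carries the maximum norm.
  -- With `G` complete, the range is closed.
  have hanti : ∀ p : G, ‖p‖ ≤ (2 : NNReal) * ‖L p‖ := by
    intro p
    obtain ⟨h, h1, h2⟩ := (mem_boundaryGraph_iff Φ hab).1 p.2
    have h3 := norm_le_norm_sub_I_smul_secondDeriv hab (v := ⟨p.1.1, h⟩)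
      (by rw [h1]; exact hΦ _)
    rw [h2] at h3
    change ‖p.1.1‖ ≤ ‖L p‖ at h3
    have h4 : ‖p.1.2‖ ≤ ‖p.1.1‖ + ‖L p‖ := by
      have : Complex.I • p.1.2 = p.1.1 - L p := by rw [hL]; abel
      calc ‖p.1.2‖ = ‖Complex.I • p.1.2‖ := by rw [norm_smul, Complex.norm_I, one_mul]
        _ ≤ _ := by rw [this]; exact norm_sub_le _ _
    rw [Submodule.coe_norm, Prod.norm_def, NNReal.coe_ofNat]
    exact max_le (by linarith [norm_nonneg (L p)]) (by linarith)
  have hcl : IsClosed (LinearMap.range L.toLinearMap : Set (L2 a b H)) := by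
    rw [LinearMap.coe_range]
    exact (AddMonoidHomClass.antilipschitz_of_bound L hanti).isClosed_range L.uniformContinuous
  have hco : CompleteSpace (LinearMap.range L.toLinearMap) := hcl.completeSpace_coe
  have htop : LinearMap.range L.toLinearMap = ⊤ := by
    rw [← Submodule.orthogonal_eq_bot_iff, Submodule.eq_bot_iff]
    intro g hg
    rw [Submodule.mem_orthogonal] at hg
    -- Orthogonality to the range says weakly that `g'' = ig`, that is `g = -ig''`, with the adjoint
    -- condition `Γ₊g = Φ*Γ₋g`. As `‖Φ*‖ ≤ 1`, this forces `g = 0`.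
    have hg' : ∀ v : H2 a b H, Γm v = Φ (Γp v) →
        inner ℂ (secondDeriv v) g = inner ℂ (v : L2 a b H) (Complex.I • g) := by
      intro v hv
      have h1 := hg _ (LinearMap.mem_range_self L.toLinearMap
        ⟨((v : L2 a b H), secondDeriv v), (mem_boundaryGraph_iff Φ hab).2 ⟨v.2, hv, rfl⟩⟩)
      change inner ℂ ((v : L2 a b H) - Complex.I • secondDeriv v) g = 0 at h1
      rw [inner_sub_left, inner_smul_left, Complex.conj_I] at h1
      rw [inner_smul_right]
      linear_combination -Complex.I * h1 + Complex.I_mul_I * inner ℂ (secondDeriv v) g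
    obtain ⟨h, h1⟩ := exists_mem_H2_of_forall_inner_eq (u := g) (f := Complex.I • g) hab
      fun φ => by
        obtain ⟨hφ, e1, e2, e3⟩ := testToL2_mem_H2 hab φ
        have := hg' ⟨_, hφ⟩ (by rw [e2, e3, map_zero])
        rwa [e1] at this
    have h2 := Γp_eq_adjoint_Γm hab (v := ⟨g, h⟩) (Ψ := Φ) fun w hw => by
      rw [inner_Γp_eq_inner_Γm_iff hab, h1]
      exact hg' w hw
    refine H2_eq_zero_of_eq_neg_I_smul hab (v := ⟨g, h⟩) ?_ ?_
    · have hn : ‖ContinuousLinearMap.adjoint Φ‖ ≤ 1 := by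
        rw [LinearIsometryEquiv.norm_map]
        exact Φ.opNorm_le_bound zero_le_one fun x => by rw [one_mul]; exact hΦ x
      rw [h2]
      exact ContinuousLinearMap.le_of_opNorm_le _ hn _ |>.trans (one_mul _).le
    · rw [h1, smul_smul, Complex.I_mul_I, neg_one_smul, neg_neg]
  obtain ⟨p, hp⟩ := LinearMap.range_eq_top.1 htop y
  obtain ⟨h, h1, h2⟩ := (mem_boundaryGraph_iff Φ hab).1 p.2
  refine ⟨⟨p.1.1, h⟩, h1, ?_⟩
  rw [h2]
  exact hp

end MaximalRange

/-! ### Selfadjoint and m-dissipative extensions of `S` -/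

section Extensions

theorem testToL2_mem_domain {H : Type*} [NormedAddCommGroup H] [InnerProductSpace ℂ H]
    {a b : ℝ}
    {T : L2 a b H →ₗ.[ℂ] L2 a b H} (hT : S a b H ≤ T) (φ : testSpace a b H) :
    ∃ h : testToL2 φ ∈ T.domain, T ⟨_, h⟩ = testToL2 (testSecondDeriv φ) := by
  have h := hT.1 (LinearMap.mem_range_self testToL2 φ)
  exact ⟨h, (hT.2 (x := ⟨_, LinearMap.mem_range_self testToL2 φ⟩) (y := ⟨_, h⟩) rfl).symm.trans
    (S_apply φ)⟩

variable {T : L2 a b H →ₗ.[ℂ] L2 a b H}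

theorem isSelfAdjoint_of_unitary (hab : a < b) (hT : S a b H ≤ T)
    {Φ : WithLp 2 (H × H) →L[ℂ] WithLp 2 (H × H)} (hΦ : Φ ∈ unitary _)
    (hD : (T.domain : Set (L2 a b H)) =
      {v | ∃ hv : v ∈ H2 a b H, Φ (Γm ⟨v, hv⟩) = Γp ⟨v, hv⟩})
    (hTv : ∀ (v : T.domain) (hv : (v : L2 a b H) ∈ H2 a b H), T v = secondDeriv ⟨v, hv⟩) :
    IsSelfAdjoint T := by
  have hD' : ∀ {v}, v ∈ T.domain ↔ ∃ hv : v ∈ H2 a b H, Φ (Γm ⟨v, hv⟩) = Γp ⟨v, hv⟩ :=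
    fun {v} => Set.ext_iff.1 hD v
  have hd : Dense (T.domain : Set (L2 a b H)) := dense_domain_S.mono hT.1
  have hadj : ContinuousLinearMap.adjoint Φ = star Φ := rfl
  have hsurj : ∀ y, Φ (ContinuousLinearMap.adjoint Φ y) = y := fun y => by
    rw [hadj, ← mul_apply_eq_comp, Unitary.mul_star_self_of_mem hΦ]
    rfl
  rw [isSelfAdjoint_iff_forall hd]
  intro u f
  constructor
  · intro h
    obtain ⟨hu, hf⟩ := exists_mem_H2_of_forall_inner_eq (u := u) (f := f) hab fun φ => by
      obtain ⟨hφ, e⟩ := testToL2_mem_domain hT φ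
      have := h ⟨_, hφ⟩
      rwa [e] at this
    have h1 := Γm_eq_adjoint_Γp hab (v := ⟨u, hu⟩) (Ψ := Φ) fun w hw => by
      have hwD : (w : L2 a b H) ∈ T.domain := hD'.2 ⟨w.2, hw.symm⟩
      rw [inner_Γp_eq_inner_Γm_iff hab, hf, ← h ⟨w, hwD⟩, hTv ⟨w, hwD⟩ w.2]
    have huD : u ∈ T.domain := hD'.2 ⟨hu, by rw [h1, hsurj]⟩
    exact ⟨huD, by rw [hTv ⟨u, huD⟩ hu, hf]⟩
  · rintro ⟨huD, rfl⟩ x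
    obtain ⟨hx, hx'⟩ := hD'.1 x.2
    obtain ⟨hu, hu'⟩ := hD'.1 huD
    rw [hTv x hx, hTv ⟨u, huD⟩ hu]
    refine (inner_Γp_eq_inner_Γm_iff hab ⟨_, hx⟩ ⟨_, hu⟩).1 ?_
    rw [← hx', ← hu', ContinuousLinearMap.inner_map_map_of_mem_unitary hΦ]

theorem exists_unitary_of_isSelfAdjoint (hab : a < b) (hT : S a b H ≤ T) (hs : IsSelfAdjoint T) :
    ∃ Φ ∈ unitary (WithLp 2 (H × H) →L[ℂ] WithLp 2 (H × H)),
      (T.domain : Set (L2 a b H)) = {v | ∃ hv : v ∈ H2 a b H, Φ (Γm ⟨v, hv⟩) = Γp ⟨v, hv⟩} ∧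
      ∀ (v : T.domain) (hv : (v : L2 a b H) ∈ H2 a b H), T v = secondDeriv ⟨v, hv⟩ := by
  have hs' := (isSelfAdjoint_iff_forall hs.dense_domain).1 hs
  have hsym : ∀ x y : T.domain, inner ℂ (T x) (y : L2 a b H) = inner ℂ (x : L2 a b H) (T y) :=
    fun x y => (hs' y (T y)).2 ⟨y.2, rfl⟩ x
  have hmax : ∀ v : T.domain, ∃ hv : (v : L2 a b H) ∈ H2 a b H, secondDeriv ⟨v, hv⟩ = T v :=
    fun v => exists_mem_H2_of_forall_inner_eq hab fun φ => by
      obtain ⟨hφ, e⟩ := testToL2_mem_domain hT φ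
      rw [← e]
      exact hsym ⟨_, hφ⟩ v
  have hle : T.domain ≤ H2 a b H := fun v hv => (hmax ⟨v, hv⟩).1
  have hsec : ∀ v : T.domain, secondDeriv (Submodule.inclusion hle v) = T v :=
    fun v => (hmax v).2
  let p := (ΓmLin H hab).comp (Submodule.inclusion hle)
  let q := (ΓpLin H hab).comp (Submodule.inclusion hle)
  have hpq : ∀ x y, inner ℂ (q x) (q y) = inner ℂ (p x) (p y) := fun x y =>
    (inner_Γp_eq_inner_Γm_iff hab _ _).2 (by rw [hsec, hsec]; exact hsym x y)
  -- Maximality of a selfadjoint operator, read at the boundary.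
  have hmem : ∀ v : H2 a b H, (∀ w, inner ℂ (q w) (Γp v) = inner ℂ (p w) (Γm v)) →
      (v : L2 a b H) ∈ T.domain := by
    intro v hv
    refine ((hs' v (secondDeriv v)).1 fun x => ?_).1
    rw [← hsec]
    exact (inner_Γp_eq_inner_Γm_iff hab (Submodule.inclusion hle x) v).1 (hv x)
  have hn : ∀ w, ‖q w‖ = ‖p w‖ := fun w => by
    rw [← sq_eq_sq₀ (norm_nonneg _) (norm_nonneg _), ← re_inner_self, ← re_inner_self, hpq]
  have hp : DenseRange p := by
    change Dense (LinearMap.range p : Set (WithLp 2 (H × H)))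
    rw [Submodule.dense_iff_topologicalClosure_eq_top, Submodule.topologicalClosure_eq_top_iff,
      Submodule.eq_bot_iff]
    intro x hx
    -- With `x` orthogonal to the range of `p` and `Γ₊v = 0`, both boundary products vanish, so `v ∈
    -- D(T)`; the isometry then gives `‖x‖ = ‖Γ₊v‖ = 0`.
    obtain ⟨v, h1, h2⟩ := exists_Γm_Γp_eq hab x 0
    have hv := hmem v fun w => by
      rw [h2, h1, inner_zero_right, (Submodule.mem_orthogonal _ _).1 hx _ ⟨w, rfl⟩]
    have : ‖q ⟨v, hv⟩‖ = ‖p ⟨v, hv⟩‖ := hn _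
    change ‖Γp v‖ = ‖Γm v‖ at this
    rw [h1, h2, norm_zero] at this
    exact norm_eq_zero.1 this.symm
  have hq : DenseRange q := by
    change Dense (LinearMap.range q : Set (WithLp 2 (H × H)))
    rw [Submodule.dense_iff_topologicalClosure_eq_top, Submodule.topologicalClosure_eq_top_iff,
      Submodule.eq_bot_iff]
    intro x hx
    obtain ⟨v, h1, h2⟩ := exists_Γm_Γp_eq hab 0 x
    have hv := hmem v fun w => by
      rw [h2, h1, inner_zero_right, (Submodule.mem_orthogonal _ _).1 hx _ ⟨w, rfl⟩]
    have : ‖q ⟨v, hv⟩‖ = ‖p ⟨v, hv⟩‖ := hn _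
    change ‖Γp v‖ = ‖Γm v‖ at this
    rw [h1, h2, norm_zero] at this
    exact norm_eq_zero.1 this
  obtain ⟨Φ, hΦ, hΦpq⟩ := exists_unitary_extension p q hp hq hn
  refine ⟨Φ, hΦ, ?_, fun v hv => (hsec v).symm⟩
  ext v
  constructor
  · exact fun hv => ⟨hle hv, hΦpq ⟨v, hv⟩⟩
  · rintro ⟨hv, hv'⟩
    refine hmem ⟨v, hv⟩ fun w => ?_
    rw [← hv', ← hΦpq, ContinuousLinearMap.inner_map_map_of_mem_unitary hΦ]

theorem isMDissipative_of_contraction (hab : a < b)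
    {Φ : WithLp 2 (H × H) →L[ℂ] WithLp 2 (H × H)} (hΦ : ∀ x, ‖Φ x‖ ≤ ‖x‖)
    (hD : (T.domain : Set (L2 a b H)) =
      {v | ∃ hv : v ∈ H2 a b H, Γm ⟨v, hv⟩ = Φ (Γp ⟨v, hv⟩)})
    (hTv : ∀ (v : T.domain) (hv : (v : L2 a b H) ∈ H2 a b H), T v = secondDeriv ⟨v, hv⟩) :
    IsMDissipative (Complex.I • T) := by
  have hD' : ∀ {v}, v ∈ T.domain ↔ ∃ hv : v ∈ H2 a b H, Γm ⟨v, hv⟩ = Φ (Γp ⟨v, hv⟩) :=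
    fun {v} => Set.ext_iff.1 hD v
  constructor
  · intro x
    obtain ⟨hx, hx'⟩ := hD'.1 x.2
    rw [LinearPMap.smul_apply, hTv x hx]
    have h1 := re_inner_I_smul_secondDeriv hab ⟨_, hx⟩
    have h2 := pow_le_pow_left₀ (norm_nonneg _) (hΦ (Γp ⟨_, hx⟩)) 2
    rw [← hx'] at h2
    linarith
  · intro y
    obtain ⟨v, h1, h2⟩ := exists_sub_I_smul_secondDeriv_eq hab hΦ y
    have hv : (v : L2 a b H) ∈ T.domain := hD'.2 ⟨v.2, h1⟩
    refine ⟨⟨v, hv⟩, ?_⟩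
    rw [LinearPMap.smul_apply]
    exact (congrArg (fun z => (v : L2 a b H) - Complex.I • z) (hTv ⟨v, hv⟩ v.2)).trans h2

theorem exists_contraction_of_isMDissipative (hab : a < b) (hT : S a b H ≤ T)
    (hm : IsMDissipative (Complex.I • T)) :
    ∃ Φ : WithLp 2 (H × H) →L[ℂ] WithLp 2 (H × H), (∀ x, ‖Φ x‖ ≤ ‖x‖) ∧
      (T.domain : Set (L2 a b H)) = {v | ∃ hv : v ∈ H2 a b H, Γm ⟨v, hv⟩ = Φ (Γp ⟨v, hv⟩)} ∧
      ∀ (v : T.domain) (hv : (v : L2 a b H) ∈ H2 a b H), T v = secondDeriv ⟨v, hv⟩ := by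
  obtain ⟨hdiss, hrange⟩ := hm
  have hmax : ∀ v : T.domain, ∃ hv : (v : L2 a b H) ∈ H2 a b H, secondDeriv ⟨v, hv⟩ = T v :=
    fun v => exists_mem_H2_of_forall_inner_eq hab fun φ => by
      obtain ⟨hφ, e⟩ := testToL2_mem_domain hT φ
      obtain ⟨hφ2, e1, e2, e3⟩ := testToL2_mem_H2 hab φ
      have h1 := re_inner_I_smul_secondDeriv hab ⟨_, hφ2⟩
      rw [e1, e2, e3, sub_self, zero_div] at h1
      -- Test functions have zero boundary values, so the form of `iT` vanishes there and `T` is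
      -- symmetric against them; hence `T` lies below the adjoint of `S`.
      have h2 := inner_add_inner_eq_zero_of_dissipative hdiss v ⟨_, hφ⟩
        (by rw [LinearPMap.smul_apply, e]; exact h1)
      rw [LinearPMap.smul_apply, LinearPMap.smul_apply, e, inner_smul_left, inner_smul_right,
        Complex.conj_I, neg_mul, neg_add_eq_zero] at h2
      have h3 := mul_left_cancel₀ Complex.I_ne_zero h2
      rw [← inner_conj_symm, ← h3, inner_conj_symm]
  have hle : T.domain ≤ H2 a b H := fun v hv => (hmax ⟨v, hv⟩).1
  have hsec : ∀ v : T.domain, secondDeriv (Submodule.inclusion hle v) = T v :=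
    fun v => (hmax v).2
  obtain ⟨Φ, hΦ, hΦpq⟩ := exists_contraction_extension
    ((ΓpLin H hab).comp (Submodule.inclusion hle)) ((ΓmLin H hab).comp (Submodule.inclusion hle))
    fun w => by
      have h1 := re_inner_I_smul_secondDeriv hab (Submodule.inclusion hle w)
      have h2 := hdiss w
      rw [LinearPMap.smul_apply, ← hsec] at h2
      change (inner ℂ (Complex.I • secondDeriv (Submodule.inclusion hle w)) (w : L2 a b H)).re = _
        at h1
      refine (sq_le_sq₀ (norm_nonneg _) (norm_nonneg _)).1 ?_
      change ‖Γm (Submodule.inclusion hle w)‖ ^ 2 ≤ ‖Γp (Submodule.inclusion hle w)‖ ^ 2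
      linarith
  refine ⟨Φ, hΦ, ?_, fun v hv => (hsec v).symm⟩
  ext v
  constructor
  · exact fun hv => ⟨hle hv, (hΦpq ⟨v, hv⟩).symm⟩
  · rintro ⟨hv, hv'⟩
    -- Solve with `w ∈ D(T)` for the same right-hand side as `v`. Both satisfy the boundary
    -- condition, so `z = v - w` does too; since `z = iz''`, it is zero.
    obtain ⟨w, hw⟩ := hrange (v - Complex.I • secondDeriv ⟨v, hv⟩)
    rw [LinearPMap.smul_apply, ← hsec] at hw
    set z : H2 a b H := ⟨v, hv⟩ - Submodule.inclusion hle w with hz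
    have hz1 : (z : L2 a b H) = v - w := rfl
    have h1 : Γm z = Φ (Γp z) := by
      rw [← ΓmLin_apply hab, ← ΓpLin_apply hab, hz, map_sub, map_sub, map_sub, ΓmLin_apply, hv']
      congr 1
      exact (hΦpq w).symm
    have h2 := H2_eq_zero_of_eq_I_smul hab (v := z) (by rw [h1]; exact hΦ _) (by
      rw [hz1, hz, map_sub, smul_sub]
      rw [sub_eq_sub_iff_sub_eq_sub] at hw
      rw [← neg_sub, hw, neg_sub])
    rw [hz1, sub_eq_zero] at h2
    rw [h2]
    exact w.2

end Extensions

end Characterization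

end SecondDerivative

open SecondDerivative in
theorem theorem6p2 {H : Type*} [NormedAddCommGroup H] [InnerProductSpace ℂ H] [CompleteSpace H]
    {a b : ℝ} (hab : a < b) (T : L2 a b H →ₗ.[ℂ] L2 a b H) (hT : S a b H ≤ T) :
    (IsSelfAdjoint T ↔
      ∃ Φ ∈ unitary (WithLp 2 (H × H) →L[ℂ] WithLp 2 (H × H)),
        (T.domain : Set (L2 a b H)) = {v | ∃ hv : v ∈ H2 a b H, Φ (Γm ⟨v, hv⟩) = Γp ⟨v, hv⟩} ∧
        ∀ (v : T.domain) (hv : (v : L2 a b H) ∈ H2 a b H), T v = secondDeriv ⟨v, hv⟩) ∧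
    (IsMDissipative (Complex.I • T) ↔
      ∃ Φ : WithLp 2 (H × H) →L[ℂ] WithLp 2 (H × H), (∀ x, ‖Φ x‖ ≤ ‖x‖) ∧
        (T.domain : Set (L2 a b H)) = {v | ∃ hv : v ∈ H2 a b H, Γm ⟨v, hv⟩ = Φ (Γp ⟨v, hv⟩)} ∧
        ∀ (v : T.domain) (hv : (v : L2 a b H) ∈ H2 a b H), T v = secondDeriv ⟨v, hv⟩) := by
  refine ⟨⟨exists_unitary_of_isSelfAdjoint hab hT, ?_⟩,
    ⟨exists_contraction_of_isMDissipative hab hT, ?_⟩⟩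
  · rintro ⟨Φ, hΦ, hD, hTv⟩
    exact isSelfAdjoint_of_unitary hab hT hΦ hD hTv
  · rintro ⟨Φ, hΦ, hD, hTv⟩
    exact isMDissipative_of_contraction hab hΦ hD hTv
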